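/- Let $m, N\ge 0$ and $T\ge 1$ be integers, let $\omega\in\mathbb C$ be a primitive root of unity of order $T$, write $\mathbb Z_T=\mathbb Z/T\mathbb Z$, and let $z_1,\dots,z_N\in\mathbb C^\times$ be points whose orbits under multiplication by powers of $\omega$ are pairwise disjoint. Let $\mathcal C_{0,N;m}$ be the arrangement in $\mathbb C^m$ (coordinates $t_1,\dots,t_m$) of the hyperplanes $t_i=\omega^k t_j$ ($i<j$, $k\in\mathbb Z_T$), $t_i=\omega^k z_j$ ($1\le i\le m$, $1\le j\le N$, $k\in\mathbb Z_T$) and $t_i=0$ ($1\le i\le m$); write $\mathcal C_{0;m}$ for it when $N=0$. For an arrangement $\mathcal C$, an edge is a non-empty intersection of hyperplanes of $\mathcal C$, and $\mathscr F^p(\mathcal C)$ is the complexification of the quotient of the free abelian group on the flags $\mathbb C^m=L^0\supset L^1\supset\dots\supset L^p$ of edges with $\operatorname{codim} L^j=j$ by the relations $\sum_{F\supset\widehat F}F=0$, one for every flag $\widehat F=(L^0\supset\dots\supset L^{i-1}\supset L^{i+1}\supset\dots\supset L^p)$ with a gap at a place $0<i<p$, the sum being over all flags $F$ that complete $\widehat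 F$. Let $\mathfrak a$ be the free complex Lie algebra on generators $f_i^{(k)}$, $1\le i\le m$, $k\in\mathbb Z_T$, let $\tau$ be its automorphism $f_i^{(k)}\mapsto f_i^{(k+1)}$, let $\bar{\mathfrak n}\subset\mathfrak a$ be the subalgebra of $\tau$-invariants, and put $\overline g=\sum_{j\in\mathbb Z_T}\tau^j g\in\bar{\mathfrak n}$ for $g\in\mathfrak a$. Grade $\mathfrak a$ by $\mathbb Z_{\ge0}^m$, giving $f_i^{(k)}$ the $i$-th unit vector as its weight; this induces weight gradings of $\bar{\mathfrak n}$, $U(\mathfrak a)$, $U(\bar{\mathfrak n})$ and of $\mathcal M_{0,N}=U(\bar{\mathfrak n})\otimes U(\mathfrak a)^{\otimes N}$. A subscript $[1^m]$ denotes the subspace of weight $(1,\dots,1)$. Then $$\dim(\mathcal M_{0,N})_{[1^m]}=\dim\mathscr F^m(\mathcal C_{0,N;m})=\prod_{k=0}^{m-1}\bigl(1+(k+N)T\bigr).$$ In particular, $$\dim U(\bar{\mathfrak n})_{[1^m]}=\dim\mathscr F^m(\mathcal C_{0;m})=\prod_{k=1}^{m-1}(1+kT).$$ Moreover $U(\bar{\mathfrak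 n})_{[1^m]}$ has the following basis, labelled by decorated Lyndon words. Order words in the letters $1,\dots,m$ reverse lexicographically (compare last letters first). A non-empty word $w$ is Lyndon if $w<vu$ for every splitting $w=uv$ into non-empty words. A decorated Lyndon word is a Lyndon word each of whose letters carries a decoration in $\mathbb Z_T$, the last letter carrying $0$. Define the bracketing $\gamma$ by $\gamma(i^{(k)})=f_i^{(k)}$ on letters and by $\gamma(w)=[\gamma(u),\gamma(v)]$ if $w$ has more than one letter, where $w=uv$ is the splitting into words $u$, $v$ that are Lyndon (decorations being ignored) with $u$ as long as possible. Then the elements $$\overline{\gamma(w_1)}\;\overline{\gamma(w_2)}\cdots\overline{\gamma(w_n)}\in U(\bar{\mathfrak n}),$$ indexed by all sequences $w_1<w_2<\dots<w_n$ of decorated Lyndon words (ordered by their underlying words) in which each of the letters $1,\dots,m$ occurs exactly once altogether, form a basis of $U(\bar{\mathfrak n})_{[1^m]}$. -/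

import Mathlib

open scoped TensorProduct

noncomputable section

namespace Cyclotomic

/-! ### Hyperplane arrangements, edges, flags and flag spaces -/

/-- The affine subspace `{t ∈ ℂ^m | l t = c}`; a hyperplane as soon as `l ≠ 0`. -/
def levelSet {m : ℕ} (l : (Fin m → ℂ) →ₗ[ℂ] ℂ) (c : ℂ) : AffineSubspace ℂ (Fin m → ℂ) where
  carrier := {t | l t = c}
  smul_vsub_vadd_mem' := by
    intro a p₁ p₂ p₃ h₁ h₂ h₃
    simp only [Set.mem_ofPred_eq] at *
    simp [h₁, h₂, h₃]

/-- The hyperplane `t_i - ω^k t_j = 0`. -/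
def hypPair {m : ℕ} (ω : ℂ) (i j : Fin m) (k : ℕ) : AffineSubspace ℂ (Fin m → ℂ) :=
  levelSet (LinearMap.proj i - ω ^ k • LinearMap.proj j) 0

/-- The hyperplane `t_i = c`. -/
def hypCoord {m : ℕ} (i : Fin m) (c : ℂ) : AffineSubspace ℂ (Fin m → ℂ) :=
  levelSet (LinearMap.proj i) c

/-- The cyclotomic discriminantal arrangement `C_{0,N;m}` in `ℂ^m`: the hyperplanes
`t_i = ω^k t_j` (`i < j`), `t_i = ω^k z_j` and `t_i = 0`. When `ω` is a root of unity of order `T`,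
the powers `ω^k` with `k ∈ ℕ` are the powers `ω^k` with `k ∈ ℤ/T`. -/
def arrangement (m : ℕ) {N : ℕ} (ω : ℂ) (z : Fin N → ℂ) :
    Set (AffineSubspace ℂ (Fin m → ℂ)) :=
  {H | (∃ i j : Fin m, i < j ∧ ∃ k : ℕ, H = hypPair ω i j k) ∨
    (∃ (i : Fin m) (j : Fin N) (k : ℕ), H = hypCoord i (ω ^ k * z j)) ∨
    (∃ i : Fin m, H = hypCoord i 0)}

/-- An edge of an arrangement: a nonempty intersection of some of its hyperplanes (the empty
intersection being the whole space). -/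
def IsEdge {m : ℕ} (C : Set (AffineSubspace ℂ (Fin m → ℂ))) (L : AffineSubspace ℂ (Fin m → ℂ)) :
    Prop :=
  (∃ S ⊆ C, L = sInf S) ∧ (L : Set (Fin m → ℂ)).Nonempty

/-- `Flag^p(C)`: flags `ℂ^m = L^0 ⊃ L^1 ⊃ … ⊃ L^p` of edges, with `L^j` of codimension `j`. -/
@[ext]
structure Flag {m : ℕ} (C : Set (AffineSubspace ℂ (Fin m → ℂ))) (p : ℕ) where
  edge : Fin (p + 1) → AffineSubspace ℂ (Fin m → ℂ)
  isEdge : ∀ j, IsEdge C (edge j)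
  codim : ∀ j, Module.finrank ℂ (edge j).direction + (j : ℕ) = m
  anti : Antitone edge

/-- The flag relations: for a flag with a gap at a place `0 < i < p`, the sum of all flags that
complete it. (The flag with a gap is given by one of its completions `F₀`; if there is none, the
relation is empty.) -/
def flagRelations {m : ℕ} (C : Set (AffineSubspace ℂ (Fin m → ℂ))) (p : ℕ) :
    Set (Flag C p →₀ ℤ) :=
  {x | ∃ (i : Fin (p + 1)) (F₀ : Flag C p), 0 < (i : ℕ) ∧ (i : ℕ) < p ∧
    x = ∑ᶠ F ∈ {F : Flag C p | ∀ j, j ≠ i → F.edge j = F₀.edge j}, Finsupp.single F (1 : ℤ)}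

/-- `F^p(C, ℤ)`. -/
abbrev IntFlagSpace {m : ℕ} (C : Set (AffineSubspace ℂ (Fin m → ℂ))) (p : ℕ) : Type :=
  (Flag C p →₀ ℤ) ⧸ Submodule.span ℤ (flagRelations C p)

/-- `F^p(C) = F^p(C, ℤ) ⊗ ℂ`. -/
abbrev FlagSpace {m : ℕ} (C : Set (AffineSubspace ℂ (Fin m → ℂ))) (p : ℕ) : Type :=
  ℂ ⊗[ℤ] IntFlagSpace C p

/-! ### The free Lie algebra with its cyclic automorphism -/

/-- The free complex Lie algebra on the generators `f_i^{(k)}`, `i = 1, …, m`, `k ∈ ℤ/T`. -/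
abbrev FreeLie (m T : ℕ) : Type := FreeLieAlgebra ℂ (Fin m × ZMod T)

/-- The generator `f_i^{(k)}`. -/
def gen {m T : ℕ} (a : Fin m × ZMod T) : FreeLie m T := FreeLieAlgebra.of ℂ a

/-- The endomorphism `f_i^{(k)} ↦ f_i^{(k+j)}`, that is, the power `τ^j`. -/
def shift {m T : ℕ} (j : ZMod T) : FreeLie m T →ₗ⁅ℂ⁆ FreeLie m T :=
  FreeLieAlgebra.lift ℂ fun a => gen (a.1, a.2 + j)

/-- The automorphism `τ : f_i^{(k)} ↦ f_i^{(k+1)}`. -/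
def tau {m T : ℕ} : FreeLie m T →ₗ⁅ℂ⁆ FreeLie m T := shift 1

theorem shift_zero {m T : ℕ} (x : FreeLie m T) : shift 0 x = x := by
  have h : (shift 0 : FreeLie m T →ₗ⁅ℂ⁆ FreeLie m T) = LieHom.id := by
    ext a
    simp [shift, gen]
  simp [h]

theorem tau_shift {m T : ℕ} (j : ZMod T) (x : FreeLie m T) :
    tau (shift j x) = shift (j + 1) x := by
  have h : (tau : FreeLie m T →ₗ⁅ℂ⁆ FreeLie m T).comp (shift j) = shift (j + 1) := by
    ext a
    simp [tau, shift, gen, add_assoc]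
  rw [← h]
  rfl

/-- The Lie subalgebra of `τ`-invariants. -/
def nbar (m T : ℕ) : LieSubalgebra ℂ (FreeLie m T) where
  carrier := {x | tau x = x}
  add_mem' := by
    intro x y hx hy
    simp only [Set.mem_ofPred_eq] at *
    rw [map_add, hx, hy]
  zero_mem' := by simp
  smul_mem' := by
    intro c x hx
    simp only [Set.mem_ofPred_eq] at *
    rw [map_smul, hx]
  lie_mem' := by
    intro x y hx hy
    have hx' : tau x = x := hx
    have hy' : tau y = y := hy
    change tau ⁅x, y⁆ = ⁅x, y⁆
    rw [LieHom.map_lie, hx', hy']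

/-- The projection `g ↦ ∑_{j ∈ ℤ/T} τ^j g` onto the `τ`-invariants. -/
def proj {m T : ℕ} [NeZero T] (g : FreeLie m T) : nbar m T :=
  ⟨∑ j : ZMod T, shift j g, by
    change tau (∑ j : ZMod T, shift j g) = ∑ j : ZMod T, shift j g
    rw [map_sum]
    simp only [tau_shift]
    exact Fintype.sum_equiv (Equiv.addRight (1 : ZMod T)) _ _ fun _ => rfl⟩

/-! ### Weights -/

/-- `HasContent g r`: `g` is an iterated commutator of generators in which, for each `i`, the
generators `f_i^{(*)}` occur `r i` times altogether. -/
inductive HasContent {m T : ℕ} : FreeLie m T → (Fin m → ℕ) → Prop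
  | gen (a : Fin m × ZMod T) : HasContent (gen a) (Pi.single a.1 1)
  | lie {g g' : FreeLie m T} {r r' : Fin m → ℕ} :
      HasContent g r → HasContent g' r' → HasContent ⁅g, g'⁆ (r + r')

/-- The weight subspaces of the free Lie algebra. -/
def weight {m T : ℕ} (r : Fin m → ℕ) : Submodule ℂ (FreeLie m T) :=
  Submodule.span ℂ {g | HasContent g r}

/-- The weight subspaces of the subalgebra of invariants. -/
def nbarWeight {m T : ℕ} (r : Fin m → ℕ) : Submodule ℂ (nbar m T) :=
  (weight r).comap (nbar m T).toSubmodule.subtype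

/-- The weight subspaces of the universal envelope of a Lie algebra with weight subspaces `W`:
spanned by the products `x_1 ⋯ x_n` of weight vectors with the prescribed total weight. -/
def envelopeWeight {m : ℕ} {L : Type} [LieRing L] [LieAlgebra ℂ L]
    (W : (Fin m → ℕ) → Submodule ℂ L) (r : Fin m → ℕ) :
    Submodule ℂ (UniversalEnvelopingAlgebra ℂ L) :=
  Submodule.span ℂ {u | ∃ l : List ((Fin m → ℕ) × L), (∀ p ∈ l, p.2 ∈ W p.1) ∧
    (l.map Prod.fst).sum = r ∧ u = (l.map fun p => UniversalEnvelopingAlgebra.ι ℂ p.2).prod}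

/-- `U(nbar)`. -/
abbrev UNbar (m T : ℕ) : Type := UniversalEnvelopingAlgebra ℂ (nbar m T)

/-- `U(a)`, for the free Lie algebra `a`. -/
abbrev UFree (m T : ℕ) : Type := UniversalEnvelopingAlgebra ℂ (FreeLie m T)

/-- `U(nbar)_r`. -/
def uNbarWeight {m T : ℕ} (r : Fin m → ℕ) : Submodule ℂ (UNbar m T) :=
  envelopeWeight nbarWeight r

/-- `U(a)_r`. -/
def uFreeWeight {m T : ℕ} (r : Fin m → ℕ) : Submodule ℂ (UFree m T) :=
  envelopeWeight weight r

/-- `M_{0,N} = U(nbar) ⊗ U(a)^{⊗ N}`. -/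
abbrev ModuleM (m T N : ℕ) : Type := UNbar m T ⊗[ℂ] (⨂[ℂ] _ : Fin N, UFree m T)

/-- `(M_{0,N})_r`: weights add up over tensor products. -/
def moduleMWeight {m T N : ℕ} (r : Fin m → ℕ) : Submodule ℂ (ModuleM m T N) :=
  Submodule.span ℂ {x | ∃ (r₀ : Fin m → ℕ) (s : Fin N → Fin m → ℕ) (u : UNbar m T)
    (v : Fin N → UFree m T), r₀ + ∑ i, s i = r ∧ u ∈ uNbarWeight r₀ ∧
      (∀ i, v i ∈ uFreeWeight (s i)) ∧ x = u ⊗ₜ[ℂ] PiTensorProduct.tprod ℂ v}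

/-- The weight `[1^m] = [1, …, 1]`. -/
def ones (m : ℕ) : Fin m → ℕ := fun _ => 1

/-! ### Decorated Lyndon words -/

/-- The reverse lexicographic order on words: compare the last letters first. -/
def RevLex {m : ℕ} (v w : List (Fin m)) : Prop := v.reverse < w.reverse

/-- A nonempty word `w` is a Lyndon word if `w < vu` in the reverse lexicographic order for every
splitting `w = uv` into nonempty words. -/
def IsLyndon {m : ℕ} (w : List (Fin m)) : Prop :=
  w ≠ [] ∧ ∀ u v : List (Fin m), u ≠ [] → v ≠ [] → w = u ++ v → RevLex w (v ++ u)

/-- Forget the decorations (in `ℤ/T`) of the letters of a decorated word. -/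
def letters {m T : ℕ} (w : List (Fin m × ZMod T)) : List (Fin m) := w.map Prod.fst

/-- A decorated Lyndon word: a Lyndon word in the letters `1, …, m`, each letter carrying a
decoration in `ℤ/T`, the last one carrying the decoration `0`. -/
def IsDecoratedLyndon {m T : ℕ} (w : List (Fin m × ZMod T)) : Prop :=
  IsLyndon (letters w) ∧ ∀ a ∈ w.getLast?, a.2 = 0

open Classical in
/-- For a Lyndon word `w` of length `> 1`, the length of `u` in the splitting `w = uv` into
(nonempty) Lyndon words `u`, `v` with `u` as long as possible. -/
def cut {m : ℕ} (w : List (Fin m)) : ℕ :=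
  Nat.findGreatest (fun k => IsLyndon (w.take k) ∧ IsLyndon (w.drop k)) (w.length - 1)

/-- The standard bracketing `γ` of a decorated Lyndon word: `γ(a) = f_a` for a letter `a`, and
`γ(w) = [γ(u), γ(v)]` for the splitting `w = uv` above. (The value `0` occurs only for words that
are not Lyndon.) -/
def bracketing {m T : ℕ} (w : List (Fin m × ZMod T)) : FreeLie m T :=
  if _h : 0 < cut (letters w) ∧ cut (letters w) < w.length then
    ⁅bracketing (w.take (cut (letters w))), bracketing (w.drop (cut (letters w)))⁆
  else
    match w with
    | [a] => gen a
    | _ => 0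
termination_by w.length
decreasing_by
  · simp only [List.length_take]; omega
  · simp only [List.length_drop]; omega

/-- The labels of the basis of `U(nbar)_{[1^m]}`: sequences of decorated Lyndon words, increasing in
the reverse lexicographic order when read from left to right, in which each of the letters
`1, …, m` occurs exactly once altogether. Forgetting the decorations, these are the factorizations
into Lyndon words of the `m!` words in which each letter occurs exactly once. -/
def LyndonLabel (m T : ℕ) : Type :=
  {ws : List (List (Fin m × ZMod T)) // (∀ w ∈ ws, IsDecoratedLyndon w) ∧
    ws.Pairwise (fun v w => RevLex (letters v) (letters w)) ∧
    ∀ i : Fin m, (letters ws.flatten).count i = 1}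

/-- The element `(∑_j τ^j γ(w_1)) ⋯ (∑_j τ^j γ(w_n))` of `U(nbar)` with label `(w_1, …, w_n)`. -/
def lyndonElement {m T : ℕ} [NeZero T] (ws : LyndonLabel m T) : UNbar m T :=
  (ws.1.map fun w => UniversalEnvelopingAlgebra.ι ℂ (proj (bracketing w))).prod

end Cyclotomic

end

open scoped TensorProduct

noncomputable section

namespace Cyclotomic

/-! ### Pivots of a subspace of `ℂ^m` -/

/-! The two dimensions are computed independently and compared as numbers; no map between `ModuleM`
and the flag space is used.

Flags. The direction of an edge has a set of pivots (coordinates determined by the earlier ones), as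
many as its codimension. Along a complete flag the pivots enter one at a time, which attaches a
permutation to the flag. Among the completions of a flag with a gap, at most one has the two pivots
at the gap in increasing order (`Flag.eq_of_perm_eq`). The flag relation therefore rewrites a flag
with an ascent as minus a sum of flags with a descent there, and flags with decreasing pivots span
(`flagClass_mem`). The arrangement is of fiber type: its hyperplanes are walls `t_i = g(t) + c` with
`g` depending only on earlier coordinates, and two walls over `t_i` that meet do so over a wall of
an earlier coordinate (`exists_wall`). Hence a flag with decreasing pivots amounts to a choice of
one wall per coordinate. Signed indicators of the flags built from a fixed choice kill all relations
(`flagFunctional_relation`) and form a dual family. The dimension is the product of the numbers of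
walls, `1 + (i + N) T` over the coordinate `i` counted from 0 (`finrank_flagSpace`).

Envelopes, spanning. In distinct letters a word is Lyndon exactly when its last letter is the least,
and standard splittings are equally explicit (`StdPair`). The Jacobi identity shows that bracketings
of Lyndon words span the multilinear weight spaces of the free Lie algebra (`lie_bracketing_mem`).
Summing over the shifts by `ZMod T` is multiplication by `T` on the invariants, so the projected
bracketings span the invariants, and the last decoration may be normalized to 0. Sorting products
costs only shorter products (`shortWeight_le_labelSpan`).

Envelopes, independence. Map the envelopes to the free associative algebra. The bracketing of a
Lyndon word is that word plus greater ones (`hasLead_bracketing`), so a product of projected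
bracketings has as leading part the product of the sums of shifted words. Uniqueness of the Lyndon
factorization recovers the underlying words, and the zero decorations at their ends select one shift
in each factor (`coeffWord_leadProd`). The resulting matrix is unitriangular. Neither the
Poincaré-Birkhoff-Witt theorem nor injectivity of these maps is needed.

Counting. Removing the first letter of a label gives recursions solved by the same product
(`exists_finset_labelSet`, `exists_finset_moduleLabelSet`). -/

open Classical in
/-- The indices `i` such that on `V` the coordinate `i` is determined by the preceding ones. -/
def pivots {m : ℕ} (V : Submodule ℂ (Fin m → ℂ)) : Finset (Fin m) :=
  Finset.univ.filter fun i => ∀ v ∈ V, (∀ j < i, v j = 0) → v i = 0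

theorem mem_pivots {m : ℕ} {V : Submodule ℂ (Fin m → ℂ)} {i : Fin m} :
    i ∈ pivots V ↔ ∀ v ∈ V, (∀ j < i, v j = 0) → v i = 0 := by
  simp [pivots]

theorem notMem_pivots {m : ℕ} {V : Submodule ℂ (Fin m → ℂ)} {i : Fin m} :
    i ∉ pivots V ↔ ∃ v ∈ V, (∀ j < i, v j = 0) ∧ v i ≠ 0 := by
  simp [pivots]

theorem pivots_anti {m : ℕ} {V W : Submodule ℂ (Fin m → ℂ)} (h : V ≤ W) :
    pivots W ⊆ pivots V := fun _ hi =>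
  mem_pivots.2 fun v hv => mem_pivots.1 hi v (h hv)

/-- A nonzero vector has a first nonzero coordinate. -/
theorem exists_leading {m : ℕ} {v : Fin m → ℂ} (hv : v ≠ 0) :
    ∃ i, v i ≠ 0 ∧ ∀ j < i, v j = 0 := by
  obtain ⟨i, hi⟩ := Function.ne_iff.1 hv
  obtain ⟨i, hi, hmin⟩ := WellFounded.has_min (wellFounded_lt (α := Fin m)) {i | v i ≠ 0} ⟨i, hi⟩
  exact ⟨i, hi, fun j hj => by_contra fun h => hmin j h hj⟩

/-- This is the echelon form. Vectors of `V` with leading coordinates at the different non-pivots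
are independent; conversely, the leading coordinate of a nonzero vector of `V` is a non-pivot, so
restriction to the non-pivot coordinates is injective on `V`. -/
theorem card_compl_pivots {m : ℕ} (V : Submodule ℂ (Fin m → ℂ)) :
    (pivots V)ᶜ.card = Module.finrank ℂ V := by
  classical
  apply le_antisymm
  · have h : ∀ i : ((pivots V)ᶜ : Finset (Fin m)), ∃ v ∈ V, (∀ j < i.1, v j = 0) ∧ v i ≠ 0 :=
      fun i => notMem_pivots.1 (Finset.mem_compl.1 i.2)
    choose v hv hv0 hv1 using h
    have hli : LinearIndependent ℂ (fun i => (⟨v i, hv i⟩ : V)) := by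
      rw [Fintype.linearIndependent_iff]
      intro c hc
      by_contra! hne
      obtain ⟨i, hi, hmin⟩ := WellFounded.has_min
        (wellFounded_lt (α := ((pivots V)ᶜ : Finset (Fin m)))) {i | c i ≠ 0} hne
      have := congrFun (congrArg Subtype.val hc) i.1
      simp only [Submodule.coe_sum, Submodule.coe_smul, Finset.sum_apply, Pi.smul_apply,
        smul_eq_mul, Submodule.coe_zero, Pi.zero_apply] at this
      rw [Finset.sum_eq_single i] at this
      · exact (mul_ne_zero hi (hv1 i)) this
      · intro j _ hj
        rcases lt_or_gt_of_ne hj with h | h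
        · rw [not_not.1 (fun h' => hmin j h' h), zero_mul]
        · rw [hv0 j i.1 h, mul_zero]
      · simp
    simpa only [Fintype.card_coe] using hli.fintype_card_le_finrank
  · let f : V →ₗ[ℂ] (((pivots V)ᶜ : Finset (Fin m)) → ℂ) :=
      { toFun := fun v i => v.1 i.1
        map_add' := fun _ _ => rfl
        map_smul' := fun _ _ => rfl }
    have hf : Function.Injective f := by
      rw [injective_iff_map_eq_zero]
      intro v hv
      by_contra hne
      obtain ⟨i, hi, hlt⟩ := exists_leading (v := v.1) (by simpa using hne)
      exact hi (congrFun hv ⟨i, Finset.mem_compl.2 (notMem_pivots.2 ⟨v, v.2, hlt, hi⟩)⟩)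
    simpa only [Module.finrank_fintype_fun_eq_card, Fintype.card_coe] using
      LinearMap.finrank_le_finrank_of_injective hf

theorem card_pivots {m : ℕ} (V : Submodule ℂ (Fin m → ℂ)) :
    Module.finrank ℂ V + (pivots V).card = m := by
  rw [← card_compl_pivots, add_comm, Finset.card_add_card_compl, Fintype.card_fin]

theorem eq_of_le_of_card_pivots {m : ℕ} {V W : Submodule ℂ (Fin m → ℂ)} (h : V ≤ W)
    (hc : (pivots V).card ≤ (pivots W).card) : V = W := by
  apply Submodule.eq_of_le_of_finrank_le h
  have := card_pivots V
  have := card_pivots W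
  omega

/-- If `W ≤ K` has one more pivot `b` than `K`, then `K` is the sum of `W` and a line spanned by a
vector with leading coordinate `b`. -/
theorem exists_leading_decomposition {m : ℕ} {W K : Submodule ℂ (Fin m → ℂ)} (h : W ≤ K)
    {b : Fin m} (hb : b ∉ pivots K) (hWK : pivots W = insert b (pivots K)) {v : Fin m → ℂ}
    (hv : v ∈ K) : ∃ u ∈ W, ∀ j < b, v j = u j := by
  obtain ⟨w, hw, hw0, hw1⟩ := notMem_pivots.1 hb
  -- The vector `w` turns `b` into a non-pivot of the sum, which is left with no more pivots than
  -- `K`.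
  have hK : W ⊔ Submodule.span ℂ {w} = K := by
    apply eq_of_le_of_card_pivots
    · exact sup_le h (Submodule.span_le.2 (by simpa using hw))
    · apply Finset.card_le_card
      have h1 : pivots (W ⊔ Submodule.span ℂ {w}) ⊆ insert b (pivots K) :=
        hWK ▸ pivots_anti le_sup_left
      have h2 : b ∉ pivots (W ⊔ Submodule.span ℂ {w}) := notMem_pivots.2
        ⟨w, Submodule.mem_sup_right (Submodule.mem_span_singleton_self w), hw0, hw1⟩
      intro i hi
      exact (Finset.mem_insert.1 (h1 hi)).resolve_left (fun h => h2 (h ▸ hi))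
  rw [← hK, Submodule.mem_sup] at hv
  obtain ⟨u, hu, x, hx, rfl⟩ := hv
  obtain ⟨c, rfl⟩ := Submodule.mem_span_singleton.1 hx
  exact ⟨u, hu, fun j hj => by simp [hw0 j hj]⟩

/-- In an interval of length two whose pivots are `a < b`, there is only one subspace in which the
pivot `a` is the first to come. -/
theorem eq_of_pivots_lt {m : ℕ} {V K K' W : Submodule ℂ (Fin m → ℂ)} (hK : K ≤ V) (hK' : K' ≤ V)
    (hW : W ≤ K) (hW' : W ≤ K') {a b : Fin m} (hab : a < b) (ha : a ∉ pivots V)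
    (hb : b ∉ insert a (pivots V)) (pK : pivots K = insert a (pivots V))
    (pK' : pivots K' = insert a (pivots V)) (pW : pivots W = insert b (insert a (pivots V))) :
    K = K' := by
  by_contra hne
  -- Both have codimension one in `V`, so if they differ they span it.
  have hsup : K ⊔ K' = V := by
    apply eq_of_le_of_card_pivots (sup_le hK hK')
    by_contra! hlt
    have h1 := Finset.card_insert_of_notMem ha
    have h2 : K = K ⊔ K' := eq_of_le_of_card_pivots le_sup_left (by rw [pK]; omega)
    have h3 : K' = K ⊔ K' := eq_of_le_of_card_pivots le_sup_right (by rw [pK']; omega)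
    exact hne (h2.trans h3.symm)
  -- A vector of `V` with leading coordinate `a` is a sum `x + y` from `K` and `K'`. Before `b`,
  -- hence up to and including `a`, both summands agree with vectors of `W`; this contradicts that
  -- `a` is a pivot of `W`.
  obtain ⟨v, hv, hv0, hv1⟩ := notMem_pivots.1 ha
  rw [← hsup, Submodule.mem_sup] at hv
  obtain ⟨x, hx, y, hy, rfl⟩ := hv
  obtain ⟨u, hu, hxu⟩ := exists_leading_decomposition hW (pK ▸ hb) (by rw [pW, pK]) hx
  obtain ⟨u', hu', hyu⟩ := exists_leading_decomposition hW' (pK' ▸ hb) (by rw [pW, pK']) hy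
  have ha' : a ∈ pivots W := by rw [pW]; simp
  have := mem_pivots.1 ha' (u + u') (add_mem hu hu') fun j hj => by
    rw [Pi.add_apply, ← hxu j (hj.trans hab), ← hyu j (hj.trans hab)]
    exact hv0 j hj
  rw [Pi.add_apply, ← hxu a hab, ← hyu a hab] at this
  exact hv1 this

/-! ### Pivots along a complete flag -/

namespace Flag

variable {m : ℕ} {C : Set (AffineSubspace ℂ (Fin m → ℂ))}

/-- The pivots of the member of codimension `j` of a flag. -/
def pivot (F : Flag C m) (j : Fin (m + 1)) : Finset (Fin m) := pivots (F.edge j).direction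

theorem card_pivot (F : Flag C m) (j : Fin (m + 1)) : (F.pivot j).card = j := by
  have h1 := F.codim j
  have h2 := card_pivots (F.edge j).direction
  rw [pivot]
  omega

theorem pivot_mono (F : Flag C m) : Monotone F.pivot := fun _ _ h =>
  pivots_anti (AffineSubspace.direction_le (F.anti h))

theorem exists_newPivot (F : Flag C m) (j : Fin m) :
    ∃ i, i ∉ F.pivot j.castSucc ∧ insert i (F.pivot j.castSucc) = F.pivot j.succ := by
  have hsub : F.pivot j.castSucc ⊆ F.pivot j.succ := F.pivot_mono (Fin.castSucc_lt_succ).le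
  have := Finset.exists_eq_insert_iff (s := F.pivot j.castSucc) (t := F.pivot j.succ)
  obtain ⟨i, hi, h⟩ := this.2 ⟨hsub, by simp [card_pivot]⟩
  exact ⟨i, hi, h⟩

/-- The pivot that is new in codimension `j + 1`. -/
def newPivot (F : Flag C m) (j : Fin m) : Fin m := (F.exists_newPivot j).choose

theorem newPivot_notMem (F : Flag C m) (j : Fin m) : F.newPivot j ∉ F.pivot j.castSucc :=
  (F.exists_newPivot j).choose_spec.1

theorem insert_newPivot (F : Flag C m) (j : Fin m) :
    insert (F.newPivot j) (F.pivot j.castSucc) = F.pivot j.succ :=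
  (F.exists_newPivot j).choose_spec.2

theorem newPivot_mem (F : Flag C m) (j : Fin m) : F.newPivot j ∈ F.pivot j.succ := by
  rw [← F.insert_newPivot]; simp

theorem newPivot_injective (F : Flag C m) : Function.Injective F.newPivot := by
  intro i j h
  by_contra hne
  wlog hij : i < j generalizing i j
  · exact this h.symm (Ne.symm hne) (lt_of_le_of_ne (not_lt.1 hij) (Ne.symm hne))
  refine F.newPivot_notMem j (h ▸ F.pivot_mono ?_ (F.newPivot_mem i))
  exact Fin.succ_le_castSucc_iff.2 hij

/-- The order in which the pivots of a complete flag occur. -/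
def perm (F : Flag C m) : Equiv.Perm (Fin m) :=
  Equiv.ofBijective F.newPivot (Finite.injective_iff_bijective.1 F.newPivot_injective)

theorem perm_mem_pivot {F : Flag C m} {i : Fin m} {j : Fin (m + 1)} :
    F.perm i ∈ F.pivot j ↔ i.castSucc < j := by
  constructor
  · intro h
    by_contra hlt
    exact F.newPivot_notMem i (F.pivot_mono (not_lt.1 hlt) h)
  · intro h
    exact F.pivot_mono (Fin.castSucc_lt_iff_succ_le.1 h) (F.newPivot_mem i)

theorem mem_pivot {F : Flag C m} {i : Fin m} {j : Fin (m + 1)} :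
    i ∈ F.pivot j ↔ (F.perm.symm i).castSucc < j := by
  rw [← perm_mem_pivot, Equiv.apply_symm_apply]

theorem pivot_eq_of_edge_eq {F F' : Flag C m} {j : Fin (m + 1)} (h : F.edge j = F'.edge j) :
    F.pivot j = F'.pivot j := by rw [pivot, pivot, h]

/-- Two flags that differ at a single place `q + 1 < m` have the same order of pivots up to a
transposition. -/
theorem perm_eq_or {F F' : Flag C m} {p q : Fin m} (hpq : p.succ = q.castSucc)
    (h : ∀ j, j ≠ q.castSucc → F.edge j = F'.edge j) :
    F.perm = F'.perm ∨ F.perm = F'.perm * Equiv.swap p q := by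
  have hpq' : (p : ℕ) + 1 = q := by simpa using congrArg Fin.val hpq
  -- Away from the gap, the new pivot is read off from two consecutive members that the flags share.
  have hoff : ∀ i, i ≠ p → i ≠ q → F.perm i = F'.perm i := by
    intro i hp hq
    have h1 : F.perm i ∈ F'.pivot i.succ := by
      rw [← pivot_eq_of_edge_eq (h i.succ _), perm_mem_pivot]
      · exact Fin.castSucc_lt_succ
      · rw [← hpq]; simpa using hp
    have h2 : F.perm i ∉ F'.pivot i.castSucc := by
      rw [← pivot_eq_of_edge_eq (h i.castSucc _), perm_mem_pivot]
      · simp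
      · simpa using hq
    rw [← F'.insert_newPivot] at h1
    exact (Finset.mem_insert.1 h1).resolve_right h2
  -- The two shared members on either side of the gap differ by two pivots, and these are the values
  -- at `p` and `q` for both flags.
  have htwo : ∀ i, i = p ∨ i = q → F.perm i = F'.perm p ∨ F.perm i = F'.perm q := by
    intro i hi
    have h1 : F.perm i ∈ F'.pivot q.succ := by
      rw [← pivot_eq_of_edge_eq (h q.succ (Fin.castSucc_lt_succ).ne'), perm_mem_pivot]
      rw [Fin.lt_def]
      rcases hi with rfl | rfl <;> simp
      omega
    have h2 : F.perm i ∉ F'.pivot p.castSucc := by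
      rw [← pivot_eq_of_edge_eq (h p.castSucc _), perm_mem_pivot]
      · rw [Fin.lt_def]
        rcases hi with rfl | rfl <;> simp
        omega
      · rw [← hpq]; exact (Fin.castSucc_lt_succ).ne
    rw [← F'.insert_newPivot, ← hpq, ← F'.insert_newPivot] at h1
    simp only [Finset.mem_insert, h2, or_false] at h1
    exact h1.symm
  have hne : p ≠ q := fun h => by rw [h] at hpq'; omega
  rcases htwo p (Or.inl rfl) with hp | hp
  · left
    have hq : F.perm q = F'.perm q := (htwo q (Or.inr rfl)).resolve_left fun hq =>
      hne (F.perm.injective (hp.trans hq.symm))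
    ext1 i
    by_cases h1 : i = p
    · rw [h1, hp]
    by_cases h2 : i = q
    · rw [h2, hq]
    exact hoff i h1 h2
  · right
    have hq : F.perm q = F'.perm p := (htwo q (Or.inr rfl)).resolve_right fun hq =>
      hne (F.perm.injective (hp.trans hq.symm))
    ext1 i
    rw [Equiv.Perm.mul_apply]
    by_cases h1 : i = p
    · rw [h1, hp, Equiv.swap_apply_left]
    by_cases h2 : i = q
    · rw [h2, hq, Equiv.swap_apply_right]
    rw [hoff i h1 h2, Equiv.swap_apply_of_ne_of_ne h1 h2]

/-- Of the flags that complete a flag with a gap, only one has the two pivots in question in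
increasing order. -/
theorem eq_of_perm_eq {F F' : Flag C m} {p q : Fin m} (hpq : p.succ = q.castSucc)
    (h : ∀ j, j ≠ q.castSucc → F.edge j = F'.edge j) (hperm : F.perm = F'.perm)
    (hlt : F.perm p < F.perm q) : F = F' := by
  have hpiv : ∀ j, F.pivot j = F'.pivot j := fun j => by
    ext i
    rw [mem_pivot, mem_pivot, hperm]
  have hp : p.castSucc ≠ q.castSucc := by rw [← hpq]; exact (Fin.castSucc_lt_succ).ne
  have hq : q.succ ≠ q.castSucc := (Fin.castSucc_lt_succ).ne'
  have hple : p.castSucc ≤ q.castSucc := by rw [← hpq]; exact (Fin.castSucc_lt_succ).le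
  have hqle : q.castSucc ≤ q.succ := (Fin.castSucc_lt_succ).le
  have hi1 := F.insert_newPivot p
  have hi2 := F.insert_newPivot q
  rw [hpq] at hi1
  rw [← hi1] at hi2
  have hdir : (F.edge q.castSucc).direction = (F'.edge q.castSucc).direction := by
    refine eq_of_pivots_lt (V := (F.edge p.castSucc).direction) (W := (F.edge q.succ).direction)
      (AffineSubspace.direction_le (F.anti hple)) ?_ (AffineSubspace.direction_le (F.anti hqle))
      ?_ hlt (F.newPivot_notMem p) ?_ hi1.symm ?_ hi2.symm
    · rw [h _ hp]
      exact AffineSubspace.direction_le (F'.anti hple)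
    · rw [h _ hq]
      exact AffineSubspace.direction_le (F'.anti hqle)
    · have := F.newPivot_notMem q
      rwa [← hi1] at this
    · exact (hpiv q.castSucc).symm.trans hi1.symm
  ext1
  funext j
  by_cases hj : j = q.castSucc
  · subst hj
    -- Equal directions suffice, since both members contain the next, nonempty member shared by the
    -- flags.
    obtain ⟨x, hx⟩ := (F.isEdge q.succ).2
    exact AffineSubspace.ext_of_direction_eq hdir ⟨x, F.anti hqle hx, F'.anti hqle (h _ hq ▸ hx)⟩
  · exact h j hj

end Flag

/-! ### Straightening of complete flags -/

/-- Finiteness matters because the flag relations are `finsum`s, which default to 0 on infinite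
supports. -/
theorem finite_flag {m : ℕ} {C : Set (AffineSubspace ℂ (Fin m → ℂ))} (hC : C.Finite) (p : ℕ) :
    Finite (Flag C p) := by
  have hE : {L | IsEdge C L}.Finite := by
    refine (hC.finite_subsets.image sInf).subset ?_
    rintro L ⟨⟨S, hS, rfl⟩, -⟩
    exact ⟨S, hS, rfl⟩
  have : Finite {L | IsEdge C L} := hE
  refine Finite.of_injective
    (fun F : Flag C p => fun j => (⟨F.edge j, F.isEdge j⟩ : {L | IsEdge C L})) ?_
  intro F F' h
  ext1
  funext j
  exact congrArg Subtype.val (congrFun h j)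

/-- The class of a flag in the flag space. -/
def flagClass {m : ℕ} {C : Set (AffineSubspace ℂ (Fin m → ℂ))} {p : ℕ} (F : Flag C p) :
    IntFlagSpace C p :=
  Submodule.Quotient.mk (Finsupp.single F 1)

theorem span_flagClass {m : ℕ} {C : Set (AffineSubspace ℂ (Fin m → ℂ))} {p : ℕ} :
    Submodule.span ℤ (Set.range (flagClass : Flag C p → IntFlagSpace C p)) = ⊤ := by
  rw [eq_top_iff]
  intro x _
  obtain ⟨x, rfl⟩ := Submodule.mkQ_surjective _ x
  induction x using Finsupp.induction_linear with
  | zero => rw [map_zero]; exact zero_mem _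
  | add x y hx hy => rw [map_add]; exact add_mem (hx trivial) (hy trivial)
  | single F n =>
    rw [← mul_one n, ← smul_eq_mul, ← Finsupp.smul_single, map_smul]
    exact Submodule.smul_mem _ _ (Submodule.subset_span ⟨F, rfl⟩)

theorem sum_flagClass {m : ℕ} {C : Set (AffineSubspace ℂ (Fin m → ℂ))} {p : ℕ}
    [Fintype (Flag C p)] {i : Fin (p + 1)} (h0 : 0 < (i : ℕ)) (hp : (i : ℕ) < p) (F₀ : Flag C p)
    [DecidablePred fun F : Flag C p => ∀ j, j ≠ i → F.edge j = F₀.edge j] :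
    ∑ F : Flag C p with ∀ j, j ≠ i → F.edge j = F₀.edge j, flagClass F = 0 := by
  have h := Submodule.subset_span (R := ℤ)
    (show _ ∈ flagRelations C p from ⟨i, F₀, h0, hp, rfl⟩)
  rw [SetLike.mem_coe, ← Submodule.Quotient.mk_eq_zero] at h
  rw [← h, finsum_mem_eq_finite_toFinset_sum _ (Set.toFinite _), ← Submodule.mkQ_apply, map_sum]
  refine Finset.sum_congr ?_ fun _ _ => rfl
  ext F
  simp

/-- A complete flag is a combination of complete flags whose pivots come in decreasing order. -/
theorem flagClass_mem {m : ℕ} {C : Set (AffineSubspace ℂ (Fin m → ℂ))} (hC : C.Finite)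
    {Q : Submodule ℤ (IntFlagSpace C m)}
    (hQ : ∀ F : Flag C m, StrictAnti F.perm → flagClass F ∈ Q) (F : Flag C m) :
    flagClass F ∈ Q := by
  classical
  have := finite_flag hC m
  have := Fintype.ofFinite (Flag C m)
  -- By the rearrangement inequality, swapping the values at an ascent lowers this sum.
  induction hn : ∑ j : Fin m, (j : ℕ) * (F.perm j : ℕ) using Nat.strong_induction_on
    generalizing F with
  | _ n ih =>
  by_cases hanti : StrictAnti F.perm
  · exact hQ F hanti
  obtain ⟨p, q, hpq, hlt⟩ : ∃ p q : Fin m, p.succ = q.castSucc ∧ F.perm p < F.perm q := by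
    by_contra! hle
    apply hanti
    cases m with
    | zero => exact fun i => i.elim0
    | succ k =>
      rw [Fin.strictAnti_iff_succ_lt]
      intro i
      refine lt_of_le_of_ne (hle i.castSucc i.succ (by simp)) fun h => ?_
      exact (Fin.castSucc_lt_succ).ne' (F.perm.injective h)
  have hpq' : (p : ℕ) + 1 = q := by simpa using congrArg Fin.val hpq
  have hsum := sum_flagClass (i := q.castSucc) (by simp; omega) (by simp) F
  rw [← Finset.add_sum_erase _ _ (a := F) (by simp)] at hsum
  rw [eq_neg_of_add_eq_zero_left hsum]
  refine neg_mem (Submodule.sum_mem _ fun G hG => ?_)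
  simp only [Finset.mem_erase, Finset.mem_filter, Finset.mem_univ, true_and] at hG
  -- Every completion other than `F` has the two pivots exchanged, because only one can have them in
  -- increasing order.
  have hperm : G.perm = F.perm * Equiv.swap p q := (Flag.perm_eq_or hpq hG.2).resolve_left
    fun h => hG.1 (Flag.eq_of_perm_eq hpq hG.2 h (by rwa [h]))
  refine ih _ ?_ G rfl
  rw [← hn, hperm]
  have hne : p ≠ q := fun h => by rw [h] at hpq'; omega
  have hq : q ∈ Finset.univ.erase p := by simp [hne.symm]
  rw [← Finset.add_sum_erase _ _ (Finset.mem_univ p), ← Finset.add_sum_erase _ _ hq,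
    ← Finset.add_sum_erase _ (fun j : Fin m => (j : ℕ) * (F.perm j : ℕ)) (Finset.mem_univ p),
    ← Finset.add_sum_erase _ (fun j : Fin m => (j : ℕ) * (F.perm j : ℕ)) hq]
  have hrest : ∑ j ∈ (Finset.univ.erase p).erase q, (j : ℕ) * ((F.perm * Equiv.swap p q) j : ℕ)
      = ∑ j ∈ (Finset.univ.erase p).erase q, (j : ℕ) * (F.perm j : ℕ) := by
    refine Finset.sum_congr rfl fun j hj => ?_
    simp only [Finset.mem_erase] at hj
    rw [Equiv.Perm.mul_apply, Equiv.swap_apply_of_ne_of_ne hj.2.1 hj.1]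
  rw [hrest, Equiv.Perm.mul_apply, Equiv.Perm.mul_apply, Equiv.swap_apply_left,
    Equiv.swap_apply_right, ← hpq']
  have hlt' : (F.perm p : ℕ) < F.perm q := hlt
  nlinarith

/-! ### Arrangements of graphs of functions of the preceding coordinates -/

theorem mem_levelSet {m : ℕ} {l : (Fin m → ℂ) →ₗ[ℂ] ℂ} {c : ℂ} {t : Fin m → ℂ} :
    t ∈ levelSet l c ↔ l t = c := Iff.rfl

/-- A triangular system of equations has a solution. -/
theorem exists_triangular_solution {m : ℕ} (f : Fin m → (Fin m → ℂ) → ℂ)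
    (hf : ∀ i t t', (∀ j < i, t j = t' j) → f i t = f i t') : ∃ t, ∀ i, t i = f i t := by
  suffices h : ∀ k : ℕ, ∃ t : Fin m → ℂ, ∀ i : Fin m, (i : ℕ) < k → t i = f i t by
    obtain ⟨t, ht⟩ := h m
    exact ⟨t, fun i => ht i i.2⟩
  intro k
  induction k with
  | zero => exact ⟨0, fun i hi => absurd hi (Nat.not_lt_zero _)⟩
  | succ k ih =>
    obtain ⟨t, ht⟩ := ih
    refine ⟨fun i => if (i : ℕ) = k then f i t else t i, fun i hi => ?_⟩
    have : f i (fun i => if (i : ℕ) = k then f i t else t i) = f i t := hf i _ _ fun j hj => by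
      have : (j : ℕ) < i := hj
      rw [if_neg (by omega)]
    rw [this]
    change (if (i : ℕ) = k then f i t else t i) = f i t
    split_ifs with h
    · rfl
    · exact ht i (by omega)

section Graphs

variable {m : ℕ} {ι : Fin m → Type} (g : ∀ i, ι i → (Fin m → ℂ) →ₗ[ℂ] ℂ) (c : ∀ i, ι i → ℂ)

/-- The hyperplane `t_i = g_i(t) + c_i`. -/
def graphHyp (i : Fin m) (b : ι i) : AffineSubspace ℂ (Fin m → ℂ) :=
  levelSet (LinearMap.proj i - g i b) (c i b)

theorem mem_graphHyp {i : Fin m} {b : ι i} {t : Fin m → ℂ} :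
    t ∈ graphHyp g c i b ↔ t i = g i b t + c i b := by
  rw [graphHyp, mem_levelSet, LinearMap.sub_apply, LinearMap.proj_apply, sub_eq_iff_eq_add']

/-- The intersection of one hyperplane for each coordinate in `D`. -/
def transversal (B : ∀ i, ι i) (D : Finset (Fin m)) : AffineSubspace ℂ (Fin m → ℂ) :=
  sInf ((fun i => graphHyp g c i (B i)) '' D)

variable {g c}

theorem mem_transversal {B : ∀ i, ι i} {D : Finset (Fin m)} {t : Fin m → ℂ} :
    t ∈ transversal g c B D ↔ ∀ i ∈ D, t i = g i (B i) t + c i (B i) := by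
  rw [transversal, AffineSubspace.mem_sInf_iff]
  simp only [Set.forall_mem_image, Finset.mem_coe, mem_graphHyp]

theorem transversal_anti (B : ∀ i, ι i) : Antitone (transversal g c B) := fun _ _ h _ ht =>
  mem_transversal.2 fun i hi => mem_transversal.1 ht i (h hi)

variable (hg : ∀ i b v, (∀ j < i, v j = 0) → g i b v = 0)

include hg in
theorem graph_congr (i : Fin m) (b : ι i) (t t' : Fin m → ℂ) (h : ∀ j < i, t j = t' j) :
    g i b t = g i b t' := by
  rw [← sub_eq_zero, ← map_sub]
  exact hg i b _ fun j hj => by rw [Pi.sub_apply, h j hj, sub_self]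

include hg in
theorem transversal_nonempty (B : ∀ i, ι i) (D : Finset (Fin m)) :
    (transversal g c B D : Set (Fin m → ℂ)).Nonempty := by
  obtain ⟨t, ht⟩ := exists_triangular_solution (fun i t => g i (B i) t + c i (B i))
    fun i t t' h => by rw [graph_congr hg i (B i) t t' h]
  exact ⟨t, mem_transversal.2 fun i _ => ht i⟩

include hg in
theorem mem_direction_transversal {B : ∀ i, ι i} {D : Finset (Fin m)} {v : Fin m → ℂ} :
    v ∈ (transversal g c B D).direction ↔ ∀ i ∈ D, v i = g i (B i) v := by
  obtain ⟨t, ht⟩ := transversal_nonempty (c := c) hg B D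
  rw [← AffineSubspace.vadd_mem_iff_mem_direction v ht, mem_transversal]
  refine forall₂_congr fun i hi => ?_
  rw [vadd_eq_add, Pi.add_apply, map_add, mem_transversal.1 ht i hi, add_assoc, add_left_inj]

include hg in
theorem pivots_transversal (B : ∀ i, ι i) (D : Finset (Fin m)) :
    pivots (transversal g c B D).direction = D := by
  classical
  ext i
  constructor
  · intro hi
    by_contra hD
    -- Solve the homogeneous equations at `D`, set the free coordinate `i` to 1 and the other free
    -- ones to 0: the leading coordinate of the solution is `i`.
    obtain ⟨v, hv⟩ := exists_triangular_solution
      (fun j t => if j ∈ D then g j (B j) t else if j = i then 1 else 0)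
      fun j t t' h => by rw [graph_congr hg j (B j) t t' h]
    refine notMem_pivots.2 ⟨v, (mem_direction_transversal hg).2 fun j hj => ?_, ?_, ?_⟩ hi
    · rw [hv j, if_pos hj]
    · intro j hj
      induction j using WellFoundedLT.induction with
      | ind j ih =>
        rw [hv j]
        split_ifs with h1 h2
        · exact hg _ _ _ fun k hk => ih k hk (hk.trans hj)
        · exact absurd h2 hj.ne
        · rfl
    · rw [hv i, if_neg hD, if_pos rfl]
      exact one_ne_zero
  · intro hi
    refine mem_pivots.2 fun v hv h => ?_
    rw [(mem_direction_transversal hg).1 hv i hi, hg _ _ _ h]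

/-- An affine subspace contained in a transversal intersection and having the same pivots equals
it. -/
theorem eq_transversal (hg : ∀ i b v, (∀ j < i, v j = 0) → g i b v = 0)
    {L : AffineSubspace ℂ (Fin m → ℂ)} (hL : (L : Set (Fin m → ℂ)).Nonempty) {B : ∀ i, ι i}
    (h : ∀ i ∈ pivots L.direction, L ≤ graphHyp g c i (B i)) :
    L = transversal g c B (pivots L.direction) := by
  have hle : L ≤ transversal g c B (pivots L.direction) := fun t ht =>
    mem_transversal.2 fun i hi => (mem_graphHyp g c).1 (h i hi ht)
  refine AffineSubspace.eq_of_direction_eq_of_nonempty_of_le ?_ hL hle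
  exact eq_of_le_of_card_pivots (AffineSubspace.direction_le hle) (by rw [pivots_transversal hg])

variable {C : Set (AffineSubspace ℂ (Fin m → ℂ))} (hC : C = {H | ∃ i b, H = graphHyp g c i b})

include hC in
theorem isEdge_transversal (hg : ∀ i b v, (∀ j < i, v j = 0) → g i b v = 0) (B : ∀ i, ι i)
    (D : Finset (Fin m)) : IsEdge C (transversal g c B D) := by
  refine ⟨⟨_, ?_, rfl⟩, transversal_nonempty hg B D⟩
  rintro _ ⟨i, -, rfl⟩
  rw [hC]
  exact ⟨i, B i, rfl⟩

/-! ### Flags built from one wall per coordinate -/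

/-- The first `j` values of a permutation. -/
def initialValues (σ : Equiv.Perm (Fin m)) (j : Fin (m + 1)) : Finset (Fin m) :=
  Finset.univ.filter fun i => (σ.symm i).castSucc < j

theorem mem_initialValues {σ : Equiv.Perm (Fin m)} {j : Fin (m + 1)} {i : Fin m} :
    i ∈ initialValues σ j ↔ (σ.symm i).castSucc < j := by
  simp [initialValues]

theorem card_initialValues (σ : Equiv.Perm (Fin m)) (j : Fin (m + 1)) :
    (initialValues σ j).card = j := by
  have h : initialValues σ j = (Finset.univ.filter fun i : Fin m => i.castSucc < j).map
      σ.toEmbedding := by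
    ext i
    simp [mem_initialValues, Finset.mem_map_equiv]
  rw [h, Finset.card_map]
  have : (Finset.univ.filter fun i : Fin m => i.castSucc < j).map Fin.castSuccEmb
      = Finset.Iio j := by
    ext i
    simp only [Finset.mem_map, Finset.mem_filter, Finset.mem_univ, true_and, Finset.mem_Iio,
      Fin.coe_castSuccEmb]
    constructor
    · rintro ⟨i, hi, rfl⟩
      exact hi
    · intro hi
      refine ⟨⟨i, ?_⟩, ?_, ?_⟩
      · have := j.2; have : (i : ℕ) < j := hi; omega
      · exact hi
      · rfl
  rw [← Finset.card_map Fin.castSuccEmb, this, Fin.card_Iio]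

/-- The flag in which the hyperplanes of a transversal family are imposed in the order `σ`. -/
def transversalFlag (hC : C = {H | ∃ i b, H = graphHyp g c i b})
    (hg : ∀ i b v, (∀ j < i, v j = 0) → g i b v = 0) (B : ∀ i, ι i) (σ : Equiv.Perm (Fin m)) :
    Flag C m where
  edge j := transversal g c B (initialValues σ j)
  isEdge j := isEdge_transversal hC hg B _
  codim j := by
    have := card_pivots (transversal g c B (initialValues σ j)).direction
    rwa [pivots_transversal hg, card_initialValues] at this
  anti j j' h := transversal_anti B fun i hi =>
    mem_initialValues.2 ((mem_initialValues.1 hi).trans_le h)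

theorem pivot_transversalFlag (hg : ∀ i b v, (∀ j < i, v j = 0) → g i b v = 0) (B : ∀ i, ι i)
    (σ : Equiv.Perm (Fin m)) (j : Fin (m + 1)) :
    (transversalFlag hC hg B σ).pivot j = initialValues σ j :=
  pivots_transversal hg B _

theorem perm_transversalFlag (hg : ∀ i b v, (∀ j < i, v j = 0) → g i b v = 0) (B : ∀ i, ι i)
    (σ : Equiv.Perm (Fin m)) : (transversalFlag hC hg B σ).perm = σ := by
  have h : ∀ i j, ((transversalFlag hC hg B σ).perm.symm i).castSucc < j ↔
      (σ.symm i).castSucc < j := fun i j => by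
    rw [← Flag.mem_pivot, pivot_transversalFlag, mem_initialValues]
  rw [← Equiv.symm_bijective.injective.eq_iff]
  ext1 i
  apply Fin.castSucc_injective
  apply le_antisymm
  · exact not_lt.1 fun hlt => lt_irrefl _ ((h i _).2 hlt)
  · exact not_lt.1 fun hlt => lt_irrefl _ ((h i _).1 hlt)

/-! ### Functionals on the flag space -/

/-- The members of a flag are intersections of hyperplanes of the family `B`. -/
def FlagIn (g : ∀ i, ι i → (Fin m → ℂ) →ₗ[ℂ] ℂ) (c : ∀ i, ι i → ℂ) (B : ∀ i, ι i)
    (F : Flag C m) : Prop :=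
  ∀ j, ∀ i ∈ F.pivot j, F.edge j ≤ graphHyp g c i (B i)

/-- A member lying in the walls of `B` over all its pivots has the dimension of their intersection,
so it equals that intersection. Thus `B` and the permutation determine the flag. -/
theorem flagIn_iff (hg : ∀ i b v, (∀ j < i, v j = 0) → g i b v = 0) {B : ∀ i, ι i}
    {F : Flag C m} : FlagIn g c B F ↔ F = transversalFlag hC hg B F.perm := by
  constructor
  · intro h
    ext1
    funext j
    refine (eq_transversal hg (F.isEdge j).2 (h j)).trans ?_
    change _ = transversal g c B (initialValues F.perm j)
    congr 1
    ext i
    rw [mem_initialValues]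
    exact Flag.mem_pivot
  · intro h
    rw [h]
    intro j i hi
    rw [pivot_transversalFlag] at hi
    exact fun t ht => (mem_graphHyp g c).2 (mem_transversal.1 ht i hi)

open Classical in
/-- The signed indicator function of the flags made from the hyperplanes of the family `B`. -/
def flagFunctional (g : ∀ i, ι i → (Fin m → ℂ) →ₗ[ℂ] ℂ) (c : ∀ i, ι i → ℂ) (B : ∀ i, ι i) :
    (Flag C m →₀ ℤ) →ₗ[ℤ] ℤ :=
  Finsupp.linearCombination ℤ fun F =>
    if FlagIn g c B F then (Equiv.Perm.sign F.perm : ℤ) else 0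

-- At a gap, the completions built from `B` are paired by exchanging the order in which the two
-- walls are imposed, and paired flags carry opposite signs.
include hC in
theorem flagFunctional_relation [∀ i, Finite (ι i)]
    (hg : ∀ i b v, (∀ j < i, v j = 0) → g i b v = 0)
    (B : ∀ i, ι i) {x : Flag C m →₀ ℤ} (hx : x ∈ flagRelations C m) :
    flagFunctional g c B x = 0 := by
  classical
  have hfin : C.Finite := by
    rw [hC]
    refine (Set.finite_range fun p : Σ i, ι i => graphHyp g c p.1 p.2).subset ?_
    rintro _ ⟨i, b, rfl⟩
    exact ⟨⟨i, b⟩, rfl⟩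
  have := finite_flag hfin m
  have := Fintype.ofFinite (Flag C m)
  obtain ⟨i, F₀, h0, hm, rfl⟩ := hx
  rw [finsum_mem_eq_finite_toFinset_sum _ (Set.toFinite _), map_sum]
  simp only [flagFunctional, Finsupp.linearCombination_single, one_smul]
  rw [← Finset.sum_filter]
  obtain ⟨p, q, hpq, rfl⟩ : ∃ p q : Fin m, p.succ = q.castSucc ∧ q.castSucc = i :=
    ⟨⟨i - 1, by omega⟩, ⟨i, hm⟩, by ext; simp; omega, by ext; simp⟩
  have hpq' : (p : ℕ) + 1 = q := by simpa using congrArg Fin.val hpq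
  have hne : p ≠ q := fun h => by rw [h] at hpq'; omega
  refine Finset.sum_involution
    (fun F _ => transversalFlag hC hg B (F.perm * Equiv.swap p q)) ?_ ?_ ?_ ?_
  · intro F _
    rw [perm_transversalFlag, Equiv.Perm.sign_mul, Equiv.Perm.sign_swap hne]
    simp
  · intro F _ _ h
    have h1 := congrArg Flag.perm h
    rw [perm_transversalFlag, mul_eq_left, Equiv.swap_eq_one_iff] at h1
    exact hne h1
  · intro F hF
    simp only [Finset.mem_filter, Set.Finite.mem_toFinset, Set.mem_ofPred_eq] at hF ⊢
    refine ⟨fun j hj => ?_, (flagIn_iff hC hg).2 (by rw [perm_transversalFlag])⟩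
    rw [← hF.1 j hj]
    conv_rhs => rw [(flagIn_iff hC hg).1 hF.2]
    change transversal g c B _ = transversal g c B _
    congr 1
    ext k
    rw [mem_initialValues, mem_initialValues, Equiv.Perm.mul_def, Equiv.symm_trans_apply,
      Equiv.symm_swap]
    -- Since `q = p + 1`, the positions below `j ≠ q` include both of `p` and `q` or neither, so the
    -- swap leaves the other members unchanged.
    have hj' : (j : ℕ) ≠ q := fun h => hj (by ext; simpa using h)
    generalize F.perm.symm k = a
    rw [Equiv.swap_apply_def, Fin.lt_def, Fin.lt_def, Fin.val_castSucc, Fin.val_castSucc]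
    split_ifs with h1 h2
    · rw [h1]; omega
    · rw [h2]; omega
    · rfl
  · intro F hF
    simp only [Finset.mem_filter] at hF
    simp only [perm_transversalFlag]
    rw [mul_assoc, Equiv.swap_mul_self, mul_one]
    exact ((flagIn_iff hC hg).1 hF.2).symm

/-! ### Arrangements of fiber type -/

theorem mem_pivots_of_le_graphHyp (hg : ∀ i b v, (∀ j < i, v j = 0) → g i b v = 0)
    {L : AffineSubspace ℂ (Fin m → ℂ)} (hL : (L : Set (Fin m → ℂ)).Nonempty) {i : Fin m} {b : ι i}
    (h : L ≤ graphHyp g c i b) : i ∈ pivots L.direction := by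
  obtain ⟨p, hp⟩ := hL
  refine mem_pivots.2 fun v hv hlt => ?_
  have h1 := (mem_graphHyp g c).1 (h hp)
  have h2 := (mem_graphHyp g c).1 (h ((AffineSubspace.vadd_mem_iff_mem_direction v hp).2 hv))
  rw [vadd_eq_add, Pi.add_apply, map_add, hg i b v hlt, zero_add, h1] at h2
  simpa using h2

-- The fiber type condition: distinct walls over one coordinate are either disjoint or meet exactly
-- over a wall of an earlier coordinate.
variable (hfib : ∀ i b b', b ≠ b' → ∀ t, t ∈ graphHyp g c i b → t ∈ graphHyp g c i b' →
  ∃ i' < i, ∃ b'', ∀ t ∈ graphHyp g c i b, (t ∈ graphHyp g c i b' ↔ t ∈ graphHyp g c i' b''))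

include hC hg hfib in
/-- If the walls in each direction meet over walls in the preceding directions, then every pivot of
an edge comes from a hyperplane. -/
theorem exists_le_graphHyp (F : Flag C m) (j : Fin (m + 1)) :
    ∀ i ∈ F.pivot j, ∃ b, F.edge j ≤ graphHyp g c i b := by
  induction j using Fin.induction with
  | zero =>
    intro i hi
    rw [Finset.card_eq_zero.1 (F.card_pivot 0)] at hi
    simp at hi
  | succ j ih =>
    have hanti : F.edge j.succ ≤ F.edge j.castSucc := F.anti (Fin.castSucc_lt_succ).le
    intro i hi
    rw [← F.insert_newPivot, Finset.mem_insert] at hi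
    rcases hi with rfl | hi
    swap
    · obtain ⟨b, hb⟩ := ih i hi
      exact ⟨b, hanti.trans hb⟩
    -- Some wall contains the new member but not the previous one, as otherwise the two members
    -- would coincide.
    have hex : {i | ∃ b, F.edge j.succ ≤ graphHyp g c i b ∧
        ¬ F.edge j.castSucc ≤ graphHyp g c i b}.Nonempty := by
      obtain ⟨S, hS, hE⟩ := (F.isEdge j.succ).1
      by_contra! hno
      have hle : F.edge j.castSucc ≤ F.edge j.succ := by
        rw [hE]
        refine le_sInf fun H hH => ?_
        have hHC := hS hH
        rw [hC] at hHC
        obtain ⟨i, b, rfl⟩ := hHC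
        by_contra hnot
        have : i ∈ (∅ : Set (Fin m)) := by
          rw [← hno]
          exact ⟨b, hE ▸ sInf_le hH, hnot⟩
        exact this
      have h1 := F.card_pivot j.succ
      have h2 := F.card_pivot j.castSucc
      have h3 : F.pivot j.succ = F.pivot j.castSucc := by
        rw [Flag.pivot, Flag.pivot, le_antisymm hanti hle]
      rw [h3, h2] at h1
      simp at h1
    -- Take such a wall over the least possible coordinate. If that coordinate were an old pivot,
    -- its old wall and the new one would meet over an earlier wall, which would also be new,
    -- against minimality. So the coordinate is the new pivot.
    obtain ⟨i, ⟨b, hb, hnb⟩, hmin⟩ := WellFounded.has_min (wellFounded_lt (α := Fin m)) _ hex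
    have hi : i ∈ F.pivot j.succ := mem_pivots_of_le_graphHyp hg (F.isEdge j.succ).2 hb
    rw [← F.insert_newPivot, Finset.mem_insert] at hi
    rcases hi with rfl | hi
    · exact ⟨b, hb⟩
    obtain ⟨b₀, hb₀⟩ := ih i hi
    obtain ⟨t, ht⟩ := (F.isEdge j.succ).2
    obtain ⟨i', hi', b'', h⟩ := hfib i b₀ b (by rintro rfl; exact hnb hb₀) t (hb₀ (hanti ht))
      (hb ht)
    refine absurd hi' (hmin i' ⟨b'', fun t ht => (h t (hb₀ (hanti ht))).1 (hb ht), fun hle => ?_⟩)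
    exact hnb fun t ht => (h t (hb₀ ht)).2 (hle ht)

-- For each coordinate, pick a wall containing the first member that has it as a pivot; the later
-- members are smaller and lie in the same wall.
include hC hg hfib in
theorem exists_flagIn (F : Flag C m) : ∃ B : ∀ i, ι i, FlagIn g c B F := by
  have h : ∀ i, ∃ b, F.edge (F.perm.symm i).succ ≤ graphHyp g c i b := fun i =>
    exists_le_graphHyp hg hC hfib F _ i (Flag.mem_pivot.2 (Fin.castSucc_lt_succ))
  choose B hB using h
  refine ⟨B, fun j i hi => (F.anti ?_).trans (hB i)⟩
  exact Fin.castSucc_lt_iff_succ_le.1 (Flag.mem_pivot.1 hi)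

-- In decreasing order, the member at which `i` enters has only pivots `≥ i`. If the families
-- differed at `i`, this member would lie in two walls over `i`, hence in a wall over some `i' < i`,
-- and `i'` would be a pivot too.
include hfib in
theorem eq_of_flagIn_revPerm {B B' : ∀ i, ι i}
    (h : FlagIn g c B (transversalFlag hC hg B' Fin.revPerm)) : B = B' := by
  by_contra hne
  obtain ⟨i, hi⟩ := Function.ne_iff.1 hne
  have hpiv := pivot_transversalFlag hC hg B' Fin.revPerm (Fin.rev i).succ
  have hmem : i ∈ (transversalFlag hC hg B' Fin.revPerm).pivot (Fin.rev i).succ := by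
    rw [hpiv, mem_initialValues, Fin.revPerm_symm, Fin.revPerm_apply]
    exact Fin.castSucc_lt_succ
  have h' : FlagIn g c B' (transversalFlag hC hg B' Fin.revPerm) :=
    (flagIn_iff hC hg).2 (by rw [perm_transversalFlag])
  obtain ⟨t, ht⟩ := ((transversalFlag hC hg B' Fin.revPerm).isEdge (Fin.rev i).succ).2
  obtain ⟨i', hi', b'', hb''⟩ := hfib i _ _ hi t (h _ i hmem ht) (h' _ i hmem ht)
  have := mem_pivots_of_le_graphHyp hg
    ((transversalFlag hC hg B' Fin.revPerm).isEdge (Fin.rev i).succ).2 (b := b'')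
    fun t ht => (hb'' t (h _ i hmem ht)).1 (h' _ i hmem ht)
  change i' ∈ (transversalFlag hC hg B' Fin.revPerm).pivot (Fin.rev i).succ at this
  rw [hpiv, mem_initialValues, Fin.revPerm_symm, Fin.revPerm_apply, Fin.castSucc_lt_succ_iff,
    Fin.rev_le_rev] at this
  exact absurd hi' (not_lt.2 this)

theorem eq_revPerm_of_strictAnti {σ : Equiv.Perm (Fin m)} (h : StrictAnti σ) :
    σ = Fin.revPerm := by
  have h1 : StrictMono (fun i => Fin.rev (σ i)) := fun i j hij => Fin.rev_lt_rev.2 (h hij)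
  have h2 : (fun i => Fin.rev (σ i)) = id := by
    refine StrictMono.range_inj h1 strictMono_id |>.1 ?_
    rw [Set.range_id, Set.range_eq_univ]
    exact Fin.rev_surjective.comp σ.surjective
  ext1 i
  rw [Fin.revPerm_apply, ← Fin.rev_eq_iff]
  exact congrFun h2 i

include hC hfib in
/-- The dimension of the top flag space of an arrangement of fiber type. -/
theorem finrank_flagSpace (hg : ∀ i b v, (∀ j < i, v j = 0) → g i b v = 0)
    [∀ i, Fintype (ι i)] :
    Module.finrank ℂ (FlagSpace C m) = ∏ i, Fintype.card (ι i) := by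
  classical
  let v : (∀ i, ι i) → IntFlagSpace C m := fun B =>
    flagClass (transversalFlag hC hg B Fin.revPerm)
  -- The sign of the reversing permutation is put in front so that the pairing with `v` is exactly
  -- the identity matrix.
  let ψ : (∀ i, ι i) → IntFlagSpace C m →ₗ[ℤ] ℤ := fun B =>
    (Equiv.Perm.sign (Fin.revPerm : Equiv.Perm (Fin m)) : ℤ) •
      (Submodule.span ℤ (flagRelations C m)).liftQ (flagFunctional g c B)
        (Submodule.span_le.2 fun x hx => flagFunctional_relation hC hg B hx)
  have hψ : ∀ B B', ψ B (v B') = if B = B' then 1 else 0 := by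
    intro B B'
    change (Equiv.Perm.sign (Fin.revPerm : Equiv.Perm (Fin m)) : ℤ) •
      flagFunctional g c B (Finsupp.single _ 1) = _
    rw [flagFunctional, Finsupp.linearCombination_single, one_smul, perm_transversalFlag]
    by_cases h : B = B'
    · subst h
      rw [if_pos rfl, if_pos ((flagIn_iff hC hg).2 (by rw [perm_transversalFlag])), smul_eq_mul,
        ← Units.val_mul, Int.units_mul_self, Units.val_one]
    · rw [if_neg h, if_neg (fun h' => h (eq_of_flagIn_revPerm hg hC hfib h')), smul_zero]
  have hli : LinearIndependent ℤ v := LinearIndependent.of_pairwise_dual_eq_zero_one v ψ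
    (fun B B' h => (hψ B B').trans (if_neg h)) (fun B => by rw [hψ, if_pos rfl])
  have hfin : C.Finite := by
    rw [hC]
    refine (Set.finite_range fun p : Σ i, ι i => graphHyp g c p.1 p.2).subset ?_
    rintro _ ⟨i, b, rfl⟩
    exact ⟨⟨i, b⟩, rfl⟩
  have hspan : ⊤ ≤ Submodule.span ℤ (Set.range v) := by
    rw [← span_flagClass, Submodule.span_le]
    rintro _ ⟨F, rfl⟩
    refine flagClass_mem hfin (fun F hF => ?_) F
    obtain ⟨B, hB⟩ := exists_flagIn hg hC hfib F
    refine Submodule.subset_span ⟨B, ?_⟩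
    rw [(flagIn_iff hC hg).1 hB, eq_revPerm_of_strictAnti hF]
  rw [Module.finrank_eq_card_basis ((Module.Basis.mk hli hspan).baseChange ℂ), Fintype.card_pi]

end Graphs

/-! ### The cyclotomic discriminantal arrangement is of fiber type -/

theorem exists_pow_mul_eq_one {T : ℕ} [NeZero T] {ω : ℂ} (hω : IsPrimitiveRoot ω T) (k : ℕ) :
    ∃ l : Fin T, ω ^ (l : ℕ) * ω ^ k = 1 := by
  -- The exponent works because `(T - 1) * k + k = T * k`.
  refine ⟨⟨(T - 1) * k % T, Nat.mod_lt _ (NeZero.pos T)⟩, ?_⟩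
  rw [← pow_eq_pow_mod _ hω.pow_eq_one, ← pow_add, ← Nat.succ_mul, Nat.succ_eq_add_one,
    Nat.sub_add_cancel (NeZero.pos T), pow_mul, hω.pow_eq_one, one_pow]

theorem exists_pow_eq_pow {T : ℕ} [NeZero T] {ω : ℂ} (hω : IsPrimitiveRoot ω T) (k : ℕ) :
    ∃ l : Fin T, ω ^ (l : ℕ) = ω ^ k :=
  ⟨⟨k % T, Nat.mod_lt _ (NeZero.pos T)⟩, (pow_eq_pow_mod _ hω.pow_eq_one).symm⟩

section Walls

variable {m N T : ℕ}

/-- Labels of the hyperplanes `t_i = 0`, `t_i = ω^k t_j` (`j < i`) and `t_i = ω^k z_s`. -/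
abbrev Wall (N T : ℕ) (i : Fin m) : Type := Option ((Fin (i : ℕ) ⊕ Fin N) × Fin T)

/-- The linear part of the right-hand side of the equation of a wall. -/
def wallLinear (ω : ℂ) (i : Fin m) : Wall N T i → (Fin m → ℂ) →ₗ[ℂ] ℂ
  | none => 0
  | some (Sum.inl j, k) => ω ^ (k : ℕ) • LinearMap.proj (Fin.castLE i.2.le j)
  | some (Sum.inr _, _) => 0

/-- The constant part of the right-hand side of the equation of a wall. -/
def wallConst (ω : ℂ) (z : Fin N → ℂ) (i : Fin m) : Wall N T i → ℂ
  | none => 0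
  | some (Sum.inl _, _) => 0
  | some (Sum.inr s, k) => ω ^ (k : ℕ) * z s

theorem wallLinear_triangular (ω : ℂ) (i : Fin m) (b : Wall N T i) (v : Fin m → ℂ)
    (hv : ∀ j < i, v j = 0) : wallLinear ω i b v = 0 := by
  match b with
  | none => rfl
  | some (Sum.inl j, k) =>
    change ω ^ (k : ℕ) • v (Fin.castLE i.2.le j) = 0
    rw [hv _ j.2, smul_zero]
  | some (Sum.inr _, _) => rfl

/-- The right-hand side of the equation of a wall. -/
def wallValue (ω : ℂ) (z : Fin N → ℂ) (i : Fin m) (b : Wall N T i) (t : Fin m → ℂ) : ℂ :=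
  wallLinear ω i b t + wallConst ω z i b

theorem wallValue_none (ω : ℂ) (z : Fin N → ℂ) (i : Fin m) (t : Fin m → ℂ) :
    wallValue ω z i (none : Wall N T i) t = 0 := by
  simp [wallValue, wallLinear, wallConst]

theorem wallValue_inl (ω : ℂ) (z : Fin N → ℂ) (i : Fin m) (j : Fin (i : ℕ)) (k : Fin T)
    (t : Fin m → ℂ) :
    wallValue ω z i (some (Sum.inl j, k)) t = ω ^ (k : ℕ) * t (Fin.castLE i.2.le j) := by
  simp [wallValue, wallLinear, wallConst]

theorem wallValue_inr (ω : ℂ) (z : Fin N → ℂ) (i : Fin m) (s : Fin N) (k : Fin T)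
    (t : Fin m → ℂ) : wallValue ω z i (some (Sum.inr s, k)) t = ω ^ (k : ℕ) * z s := by
  simp [wallValue, wallLinear, wallConst]

theorem mem_wall {ω : ℂ} {z : Fin N → ℂ} {i : Fin m} {b : Wall N T i} {t : Fin m → ℂ} :
    t ∈ graphHyp (wallLinear ω) (wallConst ω z) i b ↔ t i = wallValue ω z i b t :=
  mem_graphHyp _ _

theorem mem_hypPair {ω : ℂ} {i j : Fin m} {k : ℕ} {t : Fin m → ℂ} :
    t ∈ hypPair ω i j k ↔ t i = ω ^ k * t j := by
  rw [hypPair, mem_levelSet]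
  simp [sub_eq_zero]

theorem mem_hypCoord {i : Fin m} {c : ℂ} {t : Fin m → ℂ} : t ∈ hypCoord i c ↔ t i = c :=
  Iff.rfl

theorem eq_mul_iff_of_mul_eq_one {x y a b : ℂ} (h : x * y = 1) : a = y * b ↔ b = x * a := by
  constructor
  · rintro rfl
    rw [← mul_assoc, h, one_mul]
  · rintro rfl
    rw [← mul_assoc, mul_comm y, h, one_mul]

/-- A hyperplane `t_i = ω^k t_j` with `i < j` has to be solved for the later coordinate `t_j`, which
inverts the power of `ω`. -/
theorem arrangement_eq_walls [NeZero T] {ω : ℂ} (hω : IsPrimitiveRoot ω T) (z : Fin N → ℂ) :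
    arrangement m ω z =
      {H | ∃ (i : Fin m) (b : Wall N T i), H = graphHyp (wallLinear ω) (wallConst ω z) i b} := by
  ext H
  constructor
  · rintro (⟨i, j, hij, k, rfl⟩ | ⟨i, s, k, rfl⟩ | ⟨i, rfl⟩)
    · obtain ⟨l, hl⟩ := exists_pow_mul_eq_one hω k
      refine ⟨j, some (Sum.inl ⟨i, hij⟩, l), ?_⟩
      ext t
      rw [mem_wall, mem_hypPair, wallValue_inl, eq_mul_iff_of_mul_eq_one hl]
      rfl
    · obtain ⟨l, hl⟩ := exists_pow_eq_pow hω k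
      refine ⟨i, some (Sum.inr s, l), ?_⟩
      ext t
      rw [mem_wall, mem_hypCoord, wallValue_inr, hl]
    · refine ⟨i, none, ?_⟩
      ext t
      rw [mem_wall, mem_hypCoord, wallValue_none]
  · rintro ⟨i, b, rfl⟩
    match b with
    | none =>
      refine Or.inr (Or.inr ⟨i, ?_⟩)
      ext t
      rw [mem_wall, mem_hypCoord, wallValue_none]
    | some (Sum.inl j, k) =>
      obtain ⟨l, hl⟩ := exists_pow_mul_eq_one hω k
      refine Or.inl ⟨Fin.castLE i.2.le j, i, j.2, l, ?_⟩
      ext t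
      rw [mem_wall, mem_hypPair, wallValue_inl, eq_mul_iff_of_mul_eq_one hl]
    | some (Sum.inr s, k) =>
      refine Or.inr (Or.inl ⟨i, s, k, ?_⟩)
      ext t
      rw [mem_wall, mem_hypCoord, wallValue_inr]

/-- Two walls in the same direction that meet do so over a wall in a preceding direction. -/
theorem exists_wall [NeZero T] {ω : ℂ} (hω : IsPrimitiveRoot ω T) {z : Fin N → ℂ}
    (hz : ∀ i, z i ≠ 0) (horb : ∀ i j : Fin N, i ≠ j → ∀ k : ℕ, z i ≠ ω ^ k * z j) (i : Fin m)
    (b b' : Wall N T i) (hb : b ≠ b')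
    (hmeet : ∃ t : Fin m → ℂ, wallValue ω z i b t = wallValue ω z i b' t) :
    ∃ i' < i, ∃ b'' : Wall N T i', ∀ t : Fin m → ℂ,
      wallValue ω z i b t = wallValue ω z i b' t ↔ t i' = wallValue ω z i' b'' t := by
  have hpow : ∀ k, ω ^ k ≠ 0 := fun k => pow_ne_zero k (hω.ne_zero (NeZero.ne T))
  have hinj : ∀ k l : Fin T, ω ^ (k : ℕ) = ω ^ (l : ℕ) → k = l := fun k l h =>
    Fin.ext (hω.pow_inj k.2 l.2 h)
  have hwalls : ∀ (j : Fin (i : ℕ)) (k : Fin T) (s : Fin N) (l : Fin T),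
      ∃ i' < i, ∃ b'' : Wall N T i', ∀ t : Fin m → ℂ,
        ω ^ (k : ℕ) * t (Fin.castLE i.2.le j) = ω ^ (l : ℕ) * z s ↔
          t i' = wallValue ω z i' b'' t := by
    intro j k s l
    obtain ⟨k', hk'⟩ := exists_pow_mul_eq_one hω k
    obtain ⟨n, hn⟩ := exists_pow_eq_pow hω (k' + l)
    refine ⟨Fin.castLE i.2.le j, j.2, some (Sum.inr s, n), fun t => ?_⟩
    rw [wallValue_inr, hn, pow_add, mul_assoc, ← eq_mul_iff_of_mul_eq_one hk', eq_comm]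
  have hpairs : ∀ (j j' : Fin (i : ℕ)) (k k' : Fin T), j < j' →
      ∃ i' < i, ∃ b'' : Wall N T i', ∀ t : Fin m → ℂ,
        ω ^ (k : ℕ) * t (Fin.castLE i.2.le j) = ω ^ (k' : ℕ) * t (Fin.castLE i.2.le j') ↔
          t i' = wallValue ω z i' b'' t := by
    intro j j' k k' hj
    obtain ⟨l, hl⟩ := exists_pow_mul_eq_one hω k'
    obtain ⟨n, hn⟩ := exists_pow_eq_pow hω (l + k)
    refine ⟨Fin.castLE i.2.le j', j'.2, some (Sum.inl ⟨j, hj⟩, n), fun t => ?_⟩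
    rw [wallValue_inl, hn, pow_add, mul_assoc, eq_mul_iff_of_mul_eq_one hl]
    rfl
  have hzero : ∀ (j : Fin (i : ℕ)) (a : ℂ), a ≠ 0 → ∃ i' < i, ∃ b'' : Wall N T i',
      ∀ t : Fin m → ℂ, a * t (Fin.castLE i.2.le j) = 0 ↔ t i' = wallValue ω z i' b'' t :=
    fun j a ha => ⟨Fin.castLE i.2.le j, j.2, none, fun t => by
      rw [wallValue_none, mul_eq_zero, or_iff_right ha]⟩
  match b, b' with
  | none, none => exact absurd rfl hb
  | none, some (Sum.inl j, k) =>
    simp only [wallValue_none, wallValue_inl, eq_comm (a := (0 : ℂ))]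
    exact hzero j _ (hpow k)
  | some (Sum.inl j, k), none =>
    simp only [wallValue_none, wallValue_inl]
    exact hzero j _ (hpow k)
  | none, some (Sum.inr s, k) =>
    obtain ⟨t, ht⟩ := hmeet
    rw [wallValue_none, wallValue_inr] at ht
    exact absurd ht.symm (mul_ne_zero (hpow k) (hz s))
  | some (Sum.inr s, k), none =>
    obtain ⟨t, ht⟩ := hmeet
    rw [wallValue_none, wallValue_inr] at ht
    exact absurd ht (mul_ne_zero (hpow k) (hz s))
  | some (Sum.inl j, k), some (Sum.inr s, l) =>
    simp only [wallValue_inl, wallValue_inr]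
    exact hwalls j k s l
  | some (Sum.inr s, l), some (Sum.inl j, k) =>
    simp only [wallValue_inl, wallValue_inr, eq_comm (a := ω ^ (l : ℕ) * z s)]
    exact hwalls j k s l
  | some (Sum.inr s, k), some (Sum.inr s', k') =>
    obtain ⟨t, ht⟩ := hmeet
    rw [wallValue_inr, wallValue_inr] at ht
    -- Within one orbit, equal values force equal labels because `ω` is primitive; different orbits
    -- are disjoint. So distinct walls of this kind never meet.
    by_cases hs : s = s'
    · subst hs
      exact absurd (by rw [hinj k k' (mul_right_cancel₀ (hz s) ht)]) hb
    · obtain ⟨l, hl⟩ := exists_pow_mul_eq_one hω k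
      refine absurd ?_ (horb s s' hs (l + k'))
      rw [pow_add, mul_assoc, ← ht, ← mul_assoc, hl, one_mul]
  | some (Sum.inl j, k), some (Sum.inl j', k') =>
    simp only [wallValue_inl]
    rcases lt_trichotomy j j' with hj | hj | hj
    · exact hpairs j j' k k' hj
    · subst hj
      -- Two different multiples of the same coordinate agree only where that coordinate vanishes.
      have hk : ω ^ (k : ℕ) - ω ^ (k' : ℕ) ≠ 0 := fun h =>
        hb (by rw [hinj k k' (sub_eq_zero.1 h)])
      obtain ⟨i', hi', b'', h⟩ := hzero j _ hk
      exact ⟨i', hi', b'', fun t => by rw [← h, sub_mul, sub_eq_zero]⟩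
    · obtain ⟨i', hi', b'', h⟩ := hpairs j' j k' k hj
      exact ⟨i', hi', b'', fun t => by rw [← h, eq_comm]⟩

theorem finrank_flagSpace_arrangement [NeZero T] {ω : ℂ} (hω : IsPrimitiveRoot ω T)
    {z : Fin N → ℂ} (hz : ∀ i, z i ≠ 0)
    (horb : ∀ i j : Fin N, i ≠ j → ∀ k : ℕ, z i ≠ ω ^ k * z j) :
    Module.finrank ℂ (FlagSpace (arrangement m ω z) m)
      = ∏ k ∈ Finset.range m, (1 + (k + N) * T) := by
  have h := finrank_flagSpace (arrangement_eq_walls (m := m) hω z) (fun i b b' hb t ht ht' => by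
      rw [mem_wall] at ht ht'
      obtain ⟨i', hi', b'', h⟩ := exists_wall hω hz horb i b b' hb ⟨t, ht.symm.trans ht'⟩
      refine ⟨i', hi', b'', fun t ht => ?_⟩
      rw [mem_wall] at ht
      rw [mem_wall, mem_wall, ← h, ht]) (wallLinear_triangular ω)
  rw [h, Finset.prod_range]
  refine Finset.prod_congr rfl fun i _ => ?_
  rw [Fintype.card_option, Fintype.card_prod, Fintype.card_sum, Fintype.card_fin,
    Fintype.card_fin, Fintype.card_fin, add_comm]

end Walls

/-! ### Lyndon words in distinct letters -/

section Words

variable {m T : ℕ}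

/-- The last letter of a word is smaller than all the others. -/
def MinLast (l : List (Fin m)) : Prop := ∃ x a, l = x ++ [a] ∧ ∀ b ∈ x, a < b

/-- Every proper rotation ends in another, greater letter. -/
theorem MinLast.isLyndon {l : List (Fin m)} (h : MinLast l) : IsLyndon l := by
  obtain ⟨x, a, rfl, hx⟩ := h
  refine ⟨by simp, fun u v hu hv h => ?_⟩
  obtain ⟨u, b, rfl⟩ := (List.eq_nil_or_concat' u).resolve_left hu
  obtain ⟨v, c, rfl⟩ := (List.eq_nil_or_concat' v).resolve_left hv
  rw [← List.append_assoc] at h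
  obtain ⟨rfl, hac⟩ := List.append_inj' h rfl
  rw [RevLex, ← List.append_assoc (v ++ [c]), List.reverse_concat, List.reverse_concat]
  exact List.Lex.rel (hx b (by simp))

/-- Compare the word with its rotation that ends in `b`. -/
theorem IsLyndon.le_of_mem {x : List (Fin m)} {a b : Fin m} (h : IsLyndon (x ++ [a]))
    (hb : b ∈ x) : a ≤ b := by
  obtain ⟨y, z, rfl⟩ := List.append_of_mem hb
  have := h.2 (y ++ [b]) (z ++ [a]) (by simp) (by simp) (by simp)
  rw [RevLex, ← List.append_assoc (z ++ [a]), List.reverse_concat, List.reverse_concat] at this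
  exact List.head_le_of_lt this

theorem IsLyndon.minLast {l : List (Fin m)} (h : IsLyndon l) (hl : l.Nodup) : MinLast l := by
  obtain ⟨x, a, rfl⟩ := (List.eq_nil_or_concat' l).resolve_left h.1
  refine ⟨x, a, rfl, fun b hb => lt_of_le_of_ne (h.le_of_mem hb) ?_⟩
  rintro rfl
  exact List.disjoint_of_nodup_append hl hb (by simp)

/-- The last letter of `v` is less than the last letter of `u`, which is less than all other letters
of `u` and `v`: these are the conditions under which `u`, `v` is the standard splitting of `uv`. -/
def StdPair (u v : List (Fin m)) : Prop :=
  ∃ x b y a, u = x ++ [b] ∧ v = y ++ [a] ∧ a < b ∧ (∀ c ∈ x, b < c) ∧ ∀ c ∈ y, b < c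

theorem StdPair.left {u v : List (Fin m)} (h : StdPair u v) : MinLast u := by
  obtain ⟨x, b, y, a, rfl, rfl, hab, hx, hy⟩ := h
  exact ⟨x, b, rfl, hx⟩

theorem StdPair.right {u v : List (Fin m)} (h : StdPair u v) : MinLast v := by
  obtain ⟨x, b, y, a, rfl, rfl, hab, hx, hy⟩ := h
  exact ⟨y, a, rfl, fun c hc => hab.trans (hy c hc)⟩

theorem StdPair.append {u v : List (Fin m)} (h : StdPair u v) : MinLast (u ++ v) := by
  obtain ⟨x, b, y, a, rfl, rfl, hab, hx, hy⟩ := h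
  refine ⟨x ++ [b] ++ y, a, by simp, fun c hc => ?_⟩
  simp only [List.mem_append, List.mem_singleton] at hc
  rcases hc with (hc | rfl) | hc
  · exact hab.trans (hx c hc)
  · exact hab
  · exact hab.trans (hy c hc)

/-- A longer proper prefix contains the last letter `b` of `u` and ends in a letter of `v` greater
than `b`, so it is not Lyndon. -/
theorem StdPair.cut_eq {u v : List (Fin m)} (h : StdPair u v) : cut (u ++ v) = u.length := by
  classical
  have hu := h.left.isLyndon
  have hv := h.right.isLyndon
  have hv0 : 0 < v.length := List.length_pos_iff.2 hv.1
  rw [cut, Nat.findGreatest_eq_iff]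
  refine ⟨by rw [List.length_append]; omega, fun _ => ?_, fun n hn hle hP => ?_⟩
  · rw [List.take_left, List.drop_left]
    exact ⟨hu, hv⟩
  · obtain ⟨x, b, y, a, rfl, rfl, hab, hx, hy⟩ := h
    have hP := hP.1
    have hy0 : 0 < n - (x ++ [b]).length := by omega
    rw [List.take_append, List.take_of_length_le hn.le, List.take_append_of_le_length
      (by simp only [List.length_append, List.length_singleton] at hle hn ⊢; omega)] at hP
    have hne : y.take (n - (x ++ [b]).length) ≠ [] := by
      rw [← List.length_pos_iff, List.length_take]
      simp only [List.length_append, List.length_singleton] at hle hn ⊢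
      omega
    obtain ⟨y', c, hc⟩ := (List.eq_nil_or_concat' _).resolve_left hne
    rw [hc, ← List.append_assoc] at hP
    have h1 := hP.le_of_mem (b := b) (by simp)
    have h2 := hy c (List.mem_of_mem_take (by rw [hc]; simp))
    exact absurd h1 (not_le.2 h2)

theorem MinLast.exists_stdPair {l : List (Fin m)} (h : MinLast l) (hl : l.Nodup) :
    (∃ a, l = [a]) ∨ ∃ u v, l = u ++ v ∧ StdPair u v := by
  obtain ⟨x, a, rfl, hx⟩ := h
  by_cases hx0 : x = []
  · subst hx0
    exact Or.inl ⟨a, rfl⟩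
  -- The splitting comes right after the second smallest letter of the word.
  obtain ⟨b, hb, hmin⟩ := x.toFinset.exists_min_image id (by simpa using hx0)
  rw [List.mem_toFinset] at hb
  obtain ⟨y, z, rfl⟩ := List.append_of_mem hb
  refine Or.inr ⟨y ++ [b], z ++ [a], by simp, y, b, z, a, rfl, rfl, hx b hb, ?_, ?_⟩
  · intro c hc
    refine lt_of_le_of_ne (hmin c (by simp [hc])) ?_
    rintro rfl
    simp only [List.append_assoc] at hl
    exact List.disjoint_of_nodup_append hl hc (by simp)
  · intro c hc
    refine lt_of_le_of_ne (hmin c (by simp [hc])) ?_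
    rintro rfl
    have := (List.nodup_cons.1 (List.nodup_append.1 (List.nodup_append.1 hl).1).2.1).1
    exact this hc

theorem letters_append (u v : List (Fin m × ZMod T)) :
    letters (u ++ v) = letters u ++ letters v := List.map_append

theorem letters_length (u : List (Fin m × ZMod T)) : (letters u).length = u.length :=
  List.length_map _

/-- Induction along standard splittings. -/
theorem lyndon_induction {P : List (Fin m × ZMod T) → Prop} (single : ∀ a, P [a])
    (pair : ∀ u v, (letters (u ++ v)).Nodup → StdPair (letters u) (letters v) → P u → P v →
      P (u ++ v)) (w : List (Fin m × ZMod T)) (hn : (letters w).Nodup)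
    (hw : MinLast (letters w)) : P w := by
  induction hk : w.length using Nat.strong_induction_on generalizing w with
  | _ k ih =>
  rcases hw.exists_stdPair hn with ⟨a, ha⟩ | ⟨u, v, huv, hstd⟩
  · obtain ⟨a, rfl⟩ := List.length_eq_one_iff.1 (by rw [← letters_length, ha]; rfl : w.length = 1)
    exact single a
  · obtain ⟨w₁, w₂, rfl, rfl, rfl⟩ := List.map_eq_append_iff.1 huv
    have hn' := hn
    rw [letters_append] at hn'
    have h1 := List.length_pos_iff.2 hstd.left.isLyndon.1
    have h2 := List.length_pos_iff.2 hstd.right.isLyndon.1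
    rw [List.length_map] at h1 h2
    rw [List.length_append] at hk
    exact pair w₁ w₂ hn hstd
      (ih _ (by omega) w₁ (List.nodup_append.1 hn').1 hstd.left rfl)
      (ih _ (by omega) w₂ (List.nodup_append.1 hn').2.1 hstd.right rfl)

/-! ### Bracketings, shifts and contents of decorated words -/

theorem bracketing_singleton (a : Fin m × ZMod T) : bracketing [a] = gen a := by
  rw [bracketing]
  have : ¬ (0 < cut (letters [a]) ∧ cut (letters [a]) < [a].length) := by
    simp only [List.length_singleton]
    omega
  rw [dif_neg this]

theorem bracketing_append {u v : List (Fin m × ZMod T)} (h : StdPair (letters u) (letters v)) :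
    bracketing (u ++ v) = ⁅bracketing u, bracketing v⁆ := by
  have h1 := List.length_pos_iff.2 h.left.isLyndon.1
  have h2 := List.length_pos_iff.2 h.right.isLyndon.1
  rw [letters_length] at h1 h2
  have hcut : cut (letters (u ++ v)) = u.length := by
    rw [letters_append, h.cut_eq, letters_length]
  rw [bracketing, dif_pos (by rw [hcut, List.length_append]; omega)]
  simp only [hcut, List.take_left, List.drop_left]

/-- Shift all decorations of a word. -/
def shiftWord (j : ZMod T) (w : List (Fin m × ZMod T)) : List (Fin m × ZMod T) :=
  w.map fun a => (a.1, a.2 + j)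

theorem letters_shiftWord (j : ZMod T) (w : List (Fin m × ZMod T)) :
    letters (shiftWord j w) = letters w := by
  simp [letters, shiftWord, Function.comp_def]

theorem shift_bracketing (j : ZMod T) {w : List (Fin m × ZMod T)} (hn : (letters w).Nodup)
    (hw : MinLast (letters w)) : shift j (bracketing w) = bracketing (shiftWord j w) := by
  refine lyndon_induction (P := fun w => shift j (bracketing w) = bracketing (shiftWord j w))
    (fun a => ?_) (fun u v _ hstd hu hv => ?_) w hn hw
  · change _ = bracketing [(a.1, a.2 + j)]
    rw [bracketing_singleton, bracketing_singleton, shift, gen, FreeLieAlgebra.lift_of_apply]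
  · have : shiftWord j (u ++ v) = shiftWord j u ++ shiftWord j v := List.map_append
    rw [this, bracketing_append hstd, bracketing_append (by simpa only [letters_shiftWord]),
      LieHom.map_lie, hu, hv]

/-- The number of occurrences of each letter in a decorated word. -/
def content (w : List (Fin m × ZMod T)) : Fin m → ℕ := fun i => (letters w).count i

theorem content_append (u v : List (Fin m × ZMod T)) :
    content (u ++ v) = content u + content v := by
  funext i
  rw [content, letters_append, List.count_append]
  rfl

theorem content_singleton (a : Fin m × ZMod T) : content [a] = Pi.single a.1 1 := by
  funext i
  by_cases h : a.1 = i
  · subst h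
    simp [content, letters]
  · rw [Pi.single_eq_of_ne (Ne.symm h)]
    simp [content, letters, h]

theorem content_cons (a : Fin m × ZMod T) (w : List (Fin m × ZMod T)) :
    content (a :: w) = Pi.single a.1 1 + content w := by
  rw [← content_singleton, ← content_append]
  rfl

theorem content_shiftWord (j : ZMod T) (w : List (Fin m × ZMod T)) :
    content (shiftWord j w) = content w := by
  funext i
  rw [content, letters_shiftWord]
  rfl

theorem nodup_of_content_le {w : List (Fin m × ZMod T)} (h : content w ≤ ones m) :
    (letters w).Nodup :=
  List.nodup_iff_count_le_one.2 h

theorem perm_of_content_eq {u v : List (Fin m × ZMod T)} (h : content u = content v) :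
    (letters u).Perm (letters v) :=
  List.perm_iff_count.2 fun i => congrFun h i

theorem hasContent_bracketing {w : List (Fin m × ZMod T)} (hn : (letters w).Nodup)
    (hw : MinLast (letters w)) : HasContent (bracketing w) (content w) := by
  refine lyndon_induction (P := fun w => HasContent (bracketing w) (content w))
    (fun a => ?_) (fun u v _ hstd hu hv => ?_) w hn hw
  · rw [bracketing_singleton, content_singleton]
    exact HasContent.gen a
  · rw [bracketing_append hstd, content_append]
    exact HasContent.lie hu hv

/-! ### Bracketings of Lyndon words span -/

variable (T) in
/-- The span of the bracketings of the decorated Lyndon words of given content. -/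
def lyndonSpan (r : Fin m → ℕ) : Submodule ℂ (FreeLie m T) :=
  Submodule.span ℂ {g | ∃ w, MinLast (letters w) ∧ content w = r ∧ g = bracketing w}

theorem bracketing_mem_lyndonSpan {w : List (Fin m × ZMod T)} (hw : MinLast (letters w)) :
    bracketing w ∈ lyndonSpan T (content w) :=
  Submodule.subset_span ⟨w, hw, rfl, rfl⟩

theorem lie_mem_of_forall {r : Fin m → ℕ} {Q : Submodule ℂ (FreeLie m T)} {x y : FreeLie m T}
    (hx : x ∈ lyndonSpan T r)
    (h : ∀ w, MinLast (letters w) → content w = r → ⁅(bracketing w : FreeLie m T), y⁆ ∈ Q) : ⁅x, y⁆ ∈ Q := by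
  induction hx using Submodule.span_induction with
  | mem x hx =>
    obtain ⟨w, hw, hr, rfl⟩ := hx
    exact h w hw hr
  | zero => rw [zero_lie]; exact zero_mem _
  | add x x' _ _ hx hx' => rw [add_lie]; exact add_mem hx hx'
  | smul c x _ hx => rw [smul_lie]; exact Submodule.smul_mem _ _ hx

/-- Induction on the total length. Let `w` have the greater last letter. If `w`, `w'` is not a
standard pair, then `w'` has a standard splitting `u v`, and Jacobi gives `[[w, u], v] + [u, [w,
v]]`. By induction the inner brackets are combinations of bracketings of Lyndon words, and each of
these words forms a standard pair with the remaining factor. -/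
theorem lie_bracketing_mem (w w' : List (Fin m × ZMod T)) (hn : (letters (w ++ w')).Nodup)
    (hw : MinLast (letters w)) (hw' : MinLast (letters w')) :
    ⁅bracketing w, bracketing w'⁆ ∈ lyndonSpan T (content (w ++ w')) := by
  induction hk : w.length + w'.length using Nat.strong_induction_on generalizing w w' with
  | _ k ih =>
  have hn0 := hn
  rw [letters_append] at hn0
  have hw0 := hw
  have hw0' := hw'
  obtain ⟨x, b, hxb, hb⟩ := hw0
  obtain ⟨y, a, hya, ha⟩ := hw0'
  have hab : a ≠ b := by
    rintro rfl
    exact List.disjoint_of_nodup_append hn0 (a := a) (by simp [hxb]) (by simp [hya])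
  -- Antisymmetry of the bracket allows the two words to be exchanged.
  wlog hlt : a < b generalizing w w' x y a b
  · rw [← lie_skew, content_append, add_comm, ← content_append]
    refine neg_mem (this w' w ?_ hw' hw (by omega) ?_ y a hya ha x b hxb hb hab.symm
      (lt_of_le_of_ne (not_lt.1 hlt) hab.symm))
    · rw [letters_append, List.nodup_append_comm, ← letters_append]; exact hn
    · rw [List.nodup_append_comm]; exact hn0
  obtain ⟨hnw, hnw', hdis⟩ := List.nodup_append'.1 hn0
  by_cases hstd : StdPair (letters w) (letters w')
  · rw [← bracketing_append hstd]
    exact bracketing_mem_lyndonSpan (by rw [letters_append]; exact hstd.append)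
  rcases hw'.exists_stdPair hnw' with ⟨a', ha'⟩ | ⟨u, v, huv, hstd'⟩
  · refine absurd ⟨x, b, [], a, hxb, ?_, hlt, hb, by simp⟩ hstd
    rw [ha'] at hya
    obtain ⟨rfl, h⟩ := List.append_inj' (show [] ++ [a'] = y ++ [a] from hya) rfl
    exact ha'.trans (by simpa using h)
  obtain ⟨u, v, rfl, rfl, rfl⟩ := List.map_eq_append_iff.1 huv
  change StdPair (letters u) (letters v) at hstd'
  rw [bracketing_append hstd', leibniz_lie]
  have hu := hstd'.left
  have hv := hstd'.right
  have hstd0 := hstd'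
  obtain ⟨p, c, q, a', hp, hq, hac, hcp, hcq⟩ := hstd0
  rw [letters_append, hq, ← List.append_assoc] at hya
  obtain ⟨rfl, haa⟩ := List.append_inj' hya rfl
  obtain rfl : a' = a := by simpa using haa
  rw [letters_append] at hn0 hnw' hdis
  have hbu : ∀ d, d ∈ letters u → b ≠ d := by
    rintro d hd rfl
    exact hdis (a := b) (by simp [hxb]) (by simp [hd])
  -- If the last letter `b` of `w` were below `c`, the pair `w`, `w'` would already be standard.
  -- Hence `c` is the second smallest letter altogether.
  have hcb : c < b := by
    refine lt_of_le_of_ne (not_lt.1 fun hbc => hstd ?_) (hbu c (by simp [hp])).symm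
    refine ⟨x, b, letters u ++ q, a', hxb, by rw [letters_append, hq, List.append_assoc], hlt, hb,
      fun d hd => ?_⟩
    rw [hp] at hd
    simp only [List.mem_append, List.mem_singleton] at hd
    rcases hd with (hd | rfl) | hd
    · exact hbc.trans (hcp d hd)
    · exact hbc
    · exact hbc.trans (hcq d hd)
  have hlu := List.length_pos_iff.2 hu.isLyndon.1
  have hlv := List.length_pos_iff.2 hv.isLyndon.1
  rw [letters_length] at hlu hlv
  rw [List.length_append] at hk
  have hcw : ∀ d ∈ letters w, c < d := by
    intro d hd
    rw [hxb] at hd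
    simp only [List.mem_append, List.mem_singleton] at hd
    rcases hd with hd | rfl
    · exact hcb.trans (hb d hd)
    · exact hcb
  refine add_mem ?_ ?_
  · have h1 := ih _ (by omega) w u (by
      rw [letters_append, List.nodup_append']
      exact ⟨hnw, (List.nodup_append'.1 hnw').1, fun _ h h' => hdis h (by simp [h'])⟩) hw hu rfl
    -- A Lyndon word `s` in the letters of `w` and `u` ends in their minimum `c`, so `s`, `v` is
    -- standard.
    refine lie_mem_of_forall h1 fun s hs hsc => ?_
    have hperm := perm_of_content_eq hsc
    obtain ⟨s', c', hs', hc'⟩ := hs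
    have hcs : c ∈ letters s := by rw [hperm.mem_iff]; simp [letters_append, hp]
    have hle : ∀ d ∈ letters s, c ≤ d := by
      intro d hd
      rw [hperm.mem_iff, letters_append, hp] at hd
      simp only [List.mem_append, List.mem_singleton] at hd
      rcases hd with hd | hd | rfl
      · exact (hcw d hd).le
      · exact (hcp d hd).le
      · exact le_rfl
    obtain rfl : c' = c := by
      apply le_antisymm _ (hle c' (by simp [hs']))
      rw [hs'] at hcs
      simp only [List.mem_append, List.mem_singleton] at hcs
      rcases hcs with hcs | rfl
      · exact (hc' c hcs).le
      · exact le_rfl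
    have hstd2 : StdPair (letters s) (letters v) := ⟨s', c', q, a', hs', hq, hac, hc', hcq⟩
    rw [← bracketing_append hstd2]
    have : content (w ++ (u ++ v)) = content (s ++ v) := by
      rw [content_append s, hsc, content_append, content_append, content_append, add_assoc]
    rw [this]
    exact bracketing_mem_lyndonSpan (by rw [letters_append]; exact hstd2.append)
  · have h1 := ih _ (by omega) w v (by
      rw [letters_append, List.nodup_append']
      exact ⟨hnw, (List.nodup_append'.1 hnw').2.1, fun _ h h' => hdis h (by simp [h'])⟩) hw hv rfl
    rw [← lie_skew]
    -- A Lyndon word `s` in the letters of `w` and `v` ends in `a'`, and its other letters exceed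
    -- `c`, so `u`, `s` is standard.
    refine neg_mem (lie_mem_of_forall h1 fun s hs hsc => ?_)
    rw [← lie_skew]
    refine neg_mem ?_
    have hperm := perm_of_content_eq hsc
    obtain ⟨s', c', hs', hc'⟩ := hs
    have hcs : a' ∈ letters s := by rw [hperm.mem_iff]; simp [letters_append, hq]
    have hle : ∀ d ∈ letters s, d = a' ∨ c < d := by
      intro d hd
      rw [hperm.mem_iff, letters_append, hq] at hd
      simp only [List.mem_append, List.mem_singleton] at hd
      rcases hd with hd | hd | rfl
      · exact Or.inr (hcw d hd)
      · exact Or.inr (hcq d hd)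
      · exact Or.inl rfl
    obtain rfl : c' = a' := by
      apply le_antisymm
      · rw [hs'] at hcs
        simp only [List.mem_append, List.mem_singleton] at hcs
        rcases hcs with hcs | rfl
        · exact (hc' a' hcs).le
        · exact le_rfl
      · rcases hle c' (by simp [hs']) with h | h
        · exact h.ge
        · exact (hac.trans h).le
    have hstd2 : StdPair (letters u) (letters s) := ⟨p, c, s', c', hp, hs', hac, hcp, fun d hd =>
      (hle d (by simp [hs', hd])).resolve_left (hc' d hd).ne'⟩
    rw [← bracketing_append hstd2]
    have : content (w ++ (u ++ v)) = content (u ++ s) := by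
      rw [content_append u, hsc, content_append, content_append, content_append, add_left_comm]
    rw [this]
    exact bracketing_mem_lyndonSpan (by rw [letters_append]; exact hstd2.append)

theorem HasContent.mem_lyndonSpan {g : FreeLie m T} {r : Fin m → ℕ} (hg : HasContent g r)
    (hr : r ≤ ones m) : g ∈ lyndonSpan T r := by
  induction hg with
  | gen a =>
    rw [← bracketing_singleton, ← content_singleton]
    exact bracketing_mem_lyndonSpan ⟨[], a.1, rfl, by simp⟩
  | @lie g g' r r' _ _ ih ih' =>
    refine lie_mem_of_forall (ih (le_trans le_self_add hr)) fun w hw hwr => ?_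
    rw [← lie_skew]
    refine neg_mem (lie_mem_of_forall (ih' (le_trans le_add_self hr)) fun w' hw' hwr' => ?_)
    rw [← lie_skew, ← hwr, ← hwr', ← content_append]
    refine neg_mem (lie_bracketing_mem w w' (nodup_of_content_le ?_) hw hw')
    rwa [content_append, hwr, hwr']

theorem weight_le_lyndonSpan {r : Fin m → ℕ} (hr : r ≤ ones m) :
    weight r ≤ lyndonSpan T r :=
  Submodule.span_le.2 fun _ hg => HasContent.mem_lyndonSpan hg hr

end Words

/-! ### Products of projected Lyndon bracketings span the envelope of the invariants -/

section Invariants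

attribute [local instance] LieRing.ofAssociativeRing

variable {m T : ℕ}

theorem shift_shift (i j : ZMod T) (x : FreeLie m T) : shift i (shift j x) = shift (j + i) x := by
  have h : (shift i : FreeLie m T →ₗ⁅ℂ⁆ FreeLie m T).comp (shift j) = shift (j + i) := by
    ext a
    simp [shift, gen, add_assoc]
  rw [← h]
  rfl

theorem hasContent_shift (j : ZMod T) {g : FreeLie m T} {r : Fin m → ℕ} (h : HasContent g r) :
    HasContent (shift j g) r := by
  induction h with
  | gen a =>
    rw [shift, Cyclotomic.gen, FreeLieAlgebra.lift_of_apply]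
    exact HasContent.gen (a.1, a.2 + j)
  | lie _ _ ih ih' =>
    rw [LieHom.map_lie]
    exact HasContent.lie ih ih'

theorem lie_mem_weight {r s : Fin m → ℕ} {x y : FreeLie m T} (hx : x ∈ weight r)
    (hy : y ∈ weight s) : ⁅x, y⁆ ∈ weight (T := T) (r + s) := by
  induction hx using Submodule.span_induction with
  | mem x hx =>
    induction hy using Submodule.span_induction with
    | mem y hy => exact Submodule.subset_span (HasContent.lie hx hy)
    | zero => rw [lie_zero]; exact zero_mem _
    | add y y' _ _ hy hy' => rw [lie_add]; exact add_mem hy hy'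
    | smul c y _ hy => rw [lie_smul]; exact Submodule.smul_mem _ _ hy
  | zero => rw [zero_lie]; exact zero_mem _
  | add x x' _ _ hx hx' => rw [add_lie]; exact add_mem hx hx'
  | smul c x _ hx => rw [smul_lie]; exact Submodule.smul_mem _ _ hx

theorem lie_mem_nbarWeight {r s : Fin m → ℕ} {x y : nbar m T} (hx : x ∈ nbarWeight r)
    (hy : y ∈ nbarWeight s) : ⁅x, y⁆ ∈ nbarWeight (T := T) (r + s) :=
  lie_mem_weight (x := x.1) (y := y.1) hx hy

variable [NeZero T]

theorem shift_of_mem_nbar (j : ZMod T) (x : nbar m T) : shift j (x : FreeLie m T) = x := by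
  have h : ∀ n : ℕ, shift (n : ZMod T) (x : FreeLie m T) = x := by
    intro n
    induction n with
    | zero => rw [Nat.cast_zero, shift_zero]
    | succ n ih => rw [Nat.cast_succ, ← tau_shift, ih]; exact x.2
  rw [← ZMod.natCast_rightInverse j]
  exact h _

/-- The projection onto the invariants as a linear map. -/
def projLinear : FreeLie m T →ₗ[ℂ] nbar m T where
  toFun := proj
  map_add' x y := Subtype.ext (by simp [proj, Finset.sum_add_distrib])
  map_smul' c x := Subtype.ext (by simp [proj, Finset.smul_sum])

theorem proj_shift (j : ZMod T) (x : FreeLie m T) : proj (shift j x) = proj x := by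
  apply Subtype.ext
  simp only [proj, shift_shift]
  exact Fintype.sum_equiv (Equiv.addLeft j) _ _ fun _ => rfl

/-- Since `T` is invertible in `ℂ`, the projection carries a spanning set of a weight space to one
of its invariants. -/
theorem proj_coe (x : nbar m T) : proj (x : FreeLie m T) = (T : ℂ) • x := by
  apply Subtype.ext
  simp only [proj, shift_of_mem_nbar]
  simp [Finset.sum_const, ZMod.card, Nat.cast_smul_eq_nsmul]

theorem proj_mem_nbarWeight {g : FreeLie m T} {r : Fin m → ℕ} (hg : HasContent g r) :
    proj g ∈ nbarWeight r :=
  Submodule.sum_mem (weight r) fun j _ => Submodule.subset_span (hasContent_shift j hg)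

/-- The projection does not see a simultaneous shift of all decorations, so the last one can be
brought to 0. -/
theorem exists_decoratedLyndon {w : List (Fin m × ZMod T)} (hn : (letters w).Nodup)
    (hw : MinLast (letters w)) : ∃ w', IsDecoratedLyndon w' ∧ content w' = content w ∧
      proj (bracketing w') = proj (bracketing w) := by
  have hne : w ≠ [] := by
    rintro rfl
    exact hw.isLyndon.1 rfl
  obtain ⟨x, a, rfl⟩ := (List.eq_nil_or_concat' w).resolve_left hne
  refine ⟨shiftWord (-a.2) (x ++ [a]), ⟨?_, ?_⟩, content_shiftWord _ _, ?_⟩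
  · rw [letters_shiftWord]
    exact hw.isLyndon
  · simp [shiftWord]
  · rw [← shift_bracketing _ hn hw, proj_shift]

theorem nbarWeight_le {r : Fin m → ℕ} (hr : r ≤ ones m) : nbarWeight r ≤
    Submodule.span ℂ {x : nbar m T | ∃ w, IsDecoratedLyndon w ∧ content w = r ∧
      x = proj (bracketing w)} := by
  intro x hx
  have hT : (T : ℂ) ≠ 0 := Nat.cast_ne_zero.2 (NeZero.ne T)
  have hx' := Submodule.mem_map_of_mem (f := projLinear) (weight_le_lyndonSpan hr hx)
  have h : projLinear (x : FreeLie m T) = (T : ℂ) • x := proj_coe x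
  change projLinear (x : FreeLie m T) ∈ _ at hx'
  rw [h, lyndonSpan, Submodule.map_span] at hx'
  rw [← inv_smul_smul₀ hT x]
  refine Submodule.smul_mem _ _ (Submodule.span_mono ?_ hx')
  rintro _ ⟨_, ⟨w, hw, rfl, rfl⟩, rfl⟩
  obtain ⟨w', hw', hc, hp⟩ := exists_decoratedLyndon (nodup_of_content_le hr) hw
  exact ⟨w', hw', hc, hp.symm⟩

/-! ### Sorting products of projected bracketings -/

/-- The product of the projected bracketings of a sequence of words. -/
def lyndonProd (ws : List (List (Fin m × ZMod T))) : UNbar m T :=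
  (ws.map fun w => UniversalEnvelopingAlgebra.ι ℂ (proj (bracketing w))).prod

theorem lyndonProd_cons (w : List (Fin m × ZMod T)) (ws : List (List (Fin m × ZMod T))) :
    lyndonProd (w :: ws) =
      UniversalEnvelopingAlgebra.ι ℂ (proj (bracketing w)) * lyndonProd ws := by
  rw [lyndonProd, List.map_cons, List.prod_cons]
  rfl

/-- Increasing sequences of decorated Lyndon words. -/
def IsLabel (ws : List (List (Fin m × ZMod T))) : Prop :=
  (∀ w ∈ ws, IsDecoratedLyndon w) ∧ ws.Pairwise fun v w => RevLex (letters v) (letters w)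

variable (T) in
/-- The span of the products of projected bracketings with labels of given content. -/
def labelSpan (r : Fin m → ℕ) : Submodule ℂ (UNbar m T) :=
  Submodule.span ℂ {u | ∃ ws, IsLabel ws ∧ content ws.flatten = r ∧ u = lyndonProd ws}

variable (T) in
/-- The span of the products of fewer than `n` weight vectors, of total weight `r`. -/
def shortWeight (n : ℕ) (r : Fin m → ℕ) : Submodule ℂ (UNbar m T) :=
  Submodule.span ℂ {u | ∃ l : List ((Fin m → ℕ) × nbar m T), l.length < n ∧
    (∀ p ∈ l, p.2 ∈ nbarWeight p.1) ∧ (l.map Prod.fst).sum = r ∧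
      u = (l.map fun p => UniversalEnvelopingAlgebra.ι ℂ p.2).prod}

omit [NeZero T] in
theorem shortWeight_mono {n k : ℕ} (h : n ≤ k) (r : Fin m → ℕ) :
    shortWeight T n r ≤ shortWeight T k r := by
  refine Submodule.span_mono ?_
  rintro _ ⟨l, hl, h'⟩
  exact ⟨l, hl.trans_le h, h'⟩

omit [NeZero T] in
theorem ι_mul_mem_shortWeight {n : ℕ} {r s : Fin m → ℕ} {x : nbar m T} (hx : x ∈ nbarWeight s)
    {u : UNbar m T} (hu : u ∈ shortWeight T n r) :
    UniversalEnvelopingAlgebra.ι ℂ x * u ∈ shortWeight T (n + 1) (s + r) := by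
  induction hu using Submodule.span_induction with
  | mem u hu =>
    obtain ⟨l, hl, hw, rfl, rfl⟩ := hu
    refine Submodule.subset_span ⟨(s, x) :: l, by simpa using hl, ?_, ?_, ?_⟩
    · intro p hp
      rcases List.mem_cons.1 hp with rfl | hp
      · exact hx
      · exact hw p hp
    · rw [List.map_cons, List.sum_cons]
    · rw [List.map_cons, List.prod_cons]
  | zero => rw [mul_zero]; exact zero_mem _
  | add u u' _ _ h h' => rw [mul_add]; exact add_mem h h'
  | smul c u _ h => rw [mul_smul_comm]; exact Submodule.smul_mem _ _ h

omit [NeZero T] in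
/-- Reordering a product of weight vectors changes it by shorter products. -/
theorem prod_sub_prod_mem {l l' : List ((Fin m → ℕ) × nbar m T)} (h : l.Perm l')
    (hw : ∀ p ∈ l, p.2 ∈ nbarWeight p.1) :
    (l.map fun p => UniversalEnvelopingAlgebra.ι ℂ p.2).prod -
      (l'.map fun p => UniversalEnvelopingAlgebra.ι ℂ p.2).prod ∈
        shortWeight T l.length (l.map Prod.fst).sum := by
  induction h with
  | nil => rw [sub_self]; exact zero_mem _
  | cons p h ih =>
    rw [List.map_cons, List.map_cons, List.map_cons, List.prod_cons, List.prod_cons, ← mul_sub,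
      List.sum_cons, List.length_cons]
    exact ι_mul_mem_shortWeight (hw p (by simp)) (ih fun q hq => hw q (by simp [hq]))
  | swap p q l =>
    have h : UniversalEnvelopingAlgebra.ι ℂ q.2 * UniversalEnvelopingAlgebra.ι ℂ p.2 -
        UniversalEnvelopingAlgebra.ι ℂ p.2 * UniversalEnvelopingAlgebra.ι ℂ q.2 =
          UniversalEnvelopingAlgebra.ι ℂ ⁅q.2, p.2⁆ := by
      rw [LieHom.map_lie, Ring.lie_def]
    simp only [List.map_cons, List.prod_cons, List.sum_cons, List.length_cons]
    rw [← mul_assoc, ← mul_assoc, ← sub_mul, h, ← add_assoc]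
    -- The commutator merges two factors into one, which makes the product shorter at the same
    -- weight.
    refine Submodule.subset_span ⟨(q.1 + p.1, ⁅q.2, p.2⁆) :: l, by simp, ?_, by simp,
      by rw [List.map_cons, List.prod_cons]⟩
    intro a ha
    rcases List.mem_cons.1 ha with rfl | ha
    · exact lie_mem_nbarWeight (hw q (by simp)) (hw p (by simp))
    · exact hw a (by simp [ha])
  | trans h₁ h₂ ih₁ ih₂ =>
    have h := add_mem (ih₁ hw) (by
      have := ih₂ fun q hq => hw q (h₁.mem_iff.2 hq)
      rwa [← h₁.length_eq, ← (h₁.map Prod.fst).sum_eq] at this)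
    rwa [sub_add_sub_cancel] at h

omit [NeZero T] in
theorem content_flatten (ws : List (List (Fin m × ZMod T))) :
    content ws.flatten = (ws.map content).sum := by
  induction ws with
  | nil => rfl
  | cons w ws ih => rw [List.flatten_cons, content_append, ih, List.map_cons, List.sum_cons]

/-- A product of weight vectors is a combination of products of projected bracketings with the same
number of factors. -/
theorem prod_mem_span_lyndonProd (l : List ((Fin m → ℕ) × nbar m T))
    (hw : ∀ p ∈ l, p.2 ∈ nbarWeight p.1) (hr : (l.map Prod.fst).sum ≤ ones m) :
    (l.map fun p => UniversalEnvelopingAlgebra.ι ℂ p.2).prod ∈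
      Submodule.span ℂ {u | ∃ ws : List (List (Fin m × ZMod T)), ws.length = l.length ∧
        (∀ w ∈ ws, IsDecoratedLyndon w) ∧ content ws.flatten = (l.map Prod.fst).sum ∧
          u = lyndonProd ws} := by
  induction l with
  | nil => exact Submodule.subset_span ⟨[], rfl, by simp, rfl, rfl⟩
  | cons p l ih =>
    rw [List.map_cons, List.sum_cons] at hr
    have h2 := ih (fun q hq => hw q (by simp [hq])) (le_trans le_add_self hr)
    have h1 := Submodule.mem_map_of_mem
      (f := (UniversalEnvelopingAlgebra.ι ℂ : nbar m T →ₗ⁅ℂ⁆ UNbar m T).toLinearMap)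
      (nbarWeight_le (le_trans le_self_add hr) (hw p (by simp)))
    rw [Submodule.map_span] at h1
    have h3 := Submodule.mul_mem_mul h1 h2
    rw [Submodule.span_mul_span] at h3
    rw [List.map_cons, List.map_cons, List.prod_cons, List.sum_cons]
    refine Submodule.span_mono ?_ h3
    rintro _ ⟨_, ⟨_, ⟨w, hw, hc, rfl⟩, rfl⟩, _, ⟨ws, hlen, hws, hcs, rfl⟩, rfl⟩
    refine ⟨w :: ws, by simp [hlen], ?_, ?_, ?_⟩
    · intro v hv
      rcases List.mem_cons.1 hv with rfl | hv
      · exact hw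
      · exact hws v hv
    · rw [List.flatten_cons, content_append, hc, hcs]
    · rw [lyndonProd_cons]
      rfl

omit [NeZero T] in
theorem IsDecoratedLyndon.minLast {w : List (Fin m × ZMod T)} (h : IsDecoratedLyndon w)
    (hn : (letters w).Nodup) : MinLast (letters w) := h.1.minLast hn

omit [NeZero T] in
theorem letters_flatten (ws : List (List (Fin m × ZMod T))) :
    letters ws.flatten = (ws.map letters).flatten := by
  simp only [letters, List.map_flatten]
  rfl

omit [NeZero T] in
theorem nodup_of_mem {ws : List (List (Fin m × ZMod T))} (h : (letters ws.flatten).Nodup)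
    {w : List (Fin m × ZMod T)} (hw : w ∈ ws) : (letters w).Nodup := by
  rw [letters_flatten, List.nodup_flatten] at h
  exact h.1 _ (List.mem_map_of_mem hw)

theorem mem_nbarWeight_of_isDecoratedLyndon {w : List (Fin m × ZMod T)}
    (h : IsDecoratedLyndon w) (hn : (letters w).Nodup) :
    proj (bracketing w) ∈ nbarWeight (content w) :=
  proj_mem_nbarWeight (hasContent_bracketing hn (h.minLast hn))

theorem lyndonProd_eq (ws : List (List (Fin m × ZMod T))) :
    lyndonProd ws = ((ws.map fun w => (content w, proj (bracketing w))).map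
      fun p => UniversalEnvelopingAlgebra.ι ℂ p.2).prod := by
  rw [List.map_map]
  rfl

theorem sum_content_eq (ws : List (List (Fin m × ZMod T))) :
    ((ws.map fun w => (content w, proj (bracketing w))).map Prod.fst).sum =
      content ws.flatten := by
  rw [List.map_map, content_flatten]
  rfl

omit [NeZero T] in
theorem exists_perm_isLabel {ws : List (List (Fin m × ZMod T))}
    (hws : ∀ w ∈ ws, IsDecoratedLyndon w) (hn : (letters ws.flatten).Nodup) :
    ∃ ws', ws.Perm ws' ∧ IsLabel ws' := by
  classical
  let R : List (Fin m × ZMod T) → List (Fin m × ZMod T) → Prop :=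
    fun v w => (letters v).reverse ≤ (letters w).reverse
  have : Std.Total R := ⟨fun v w => le_total _ _⟩
  have : IsTrans _ R := ⟨fun u v w h h' => le_trans h h'⟩
  have hp := (List.perm_insertionSort R ws).symm
  refine ⟨_, hp, fun w hw => hws w (hp.mem_iff.2 hw), ?_⟩
  have h1 : (List.insertionSort R ws).Pairwise R := List.pairwise_insertionSort R ws
  have h2 : (letters (List.insertionSort R ws).flatten).Nodup :=
    ((hp.flatten.map Prod.fst).nodup_iff).1 hn
  rw [letters_flatten, List.nodup_flatten, List.pairwise_map] at h2
  -- Sorting gives a weak order; it is strict because different words of the sequence share no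
  -- letter and are nonempty.
  refine (h1.and h2.2).imp_of_mem fun {v w} hv _ h => lt_of_le_of_ne h.1 fun he => ?_
  have hne : letters v ≠ [] := (hws v (hp.mem_iff.2 hv)).1.1
  obtain ⟨a, ha⟩ := List.exists_mem_of_ne_nil _ hne
  exact h.2 ha (List.reverse_injective he ▸ ha)

/-- This is the spanning half of Poincaré-Birkhoff-Witt, by induction on the number of factors:
expand into projected bracketings, sort, and absorb the error, which consists of shorter products.
-/
theorem shortWeight_le_labelSpan {r : Fin m → ℕ} (hr : r ≤ ones m) (n : ℕ) :
    shortWeight T n r ≤ labelSpan T r := by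
  induction n with
  | zero =>
    refine Submodule.span_le.2 ?_
    rintro _ ⟨l, hl, -⟩
    exact absurd hl (Nat.not_lt_zero _)
  | succ n ih =>
    refine Submodule.span_le.2 ?_
    rintro _ ⟨l, hl, hw, rfl, rfl⟩
    refine Submodule.span_le.2 ?_ (prod_mem_span_lyndonProd l hw hr)
    rintro _ ⟨ws, hlen, hws, hc, rfl⟩
    have hn : (letters ws.flatten).Nodup := nodup_of_content_le (hc ▸ hr)
    obtain ⟨ws', hperm, hlab⟩ := exists_perm_isLabel hws hn
    have h := prod_sub_prod_mem (hperm.map fun w => (content w, proj (bracketing w))) (by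
      intro p hp
      obtain ⟨w, hw, rfl⟩ := List.mem_map.1 hp
      exact mem_nbarWeight_of_isDecoratedLyndon (hws w hw) (nodup_of_mem hn hw))
    rw [← lyndonProd_eq, ← lyndonProd_eq, sum_content_eq, List.length_map, hc] at h
    rw [← sub_add_cancel (lyndonProd ws) (lyndonProd ws')]
    refine add_mem (ih (shortWeight_mono (by omega) _ h)) (Submodule.subset_span ⟨ws', hlab, ?_, rfl⟩)
    rw [← hc, content_flatten, content_flatten, (hperm.map content).sum_eq]

theorem uNbarWeight_eq_labelSpan {r : Fin m → ℕ} (hr : r ≤ ones m) :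
    uNbarWeight r = labelSpan T r := by
  apply le_antisymm
  · refine Submodule.span_le.2 ?_
    rintro _ ⟨l, hw, hl, rfl⟩
    exact shortWeight_le_labelSpan hr (l.length + 1)
      (Submodule.subset_span ⟨l, Nat.lt_succ_self _, hw, hl, rfl⟩)
  · refine Submodule.span_le.2 ?_
    rintro _ ⟨ws, hws, hc, rfl⟩
    have hn : (letters ws.flatten).Nodup := nodup_of_content_le (hc ▸ hr)
    refine Submodule.subset_span ⟨_, ?_, (sum_content_eq ws).trans hc, lyndonProd_eq ws⟩
    intro p hp
    obtain ⟨w, hw, rfl⟩ := List.mem_map.1 hp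
    exact mem_nbarWeight_of_isDecoratedLyndon (hws.1 w hw) (nodup_of_mem hn hw)

end Invariants

/-! ### Leading words in the free associative algebra -/

section Leading

attribute [local instance] LieRing.ofAssociativeRing

variable {m T : ℕ}

variable (m T) in
/-- The free associative algebra on the generators `f_i^{(k)}`. -/
abbrev WordAlgebra : Type := MonoidAlgebra ℂ (FreeMonoid (Fin m × ZMod T))

/-- A word as an element of the free associative algebra. -/
def word (w : List (Fin m × ZMod T)) : WordAlgebra m T :=
  MonoidAlgebra.single (FreeMonoid.ofList w) 1

theorem word_append (u v : List (Fin m × ZMod T)) : word (u ++ v) = word u * word v := by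
  rw [word, word, word, MonoidAlgebra.single_mul_single, one_mul]
  rfl

/-- The coefficient of a word. -/
def coeffWord (w : List (Fin m × ZMod T)) : WordAlgebra m T →ₗ[ℂ] ℂ :=
  Finsupp.lapply (FreeMonoid.ofList w) ∘ₗ
    (MonoidAlgebra.coeffLinearEquiv (R := ℂ) (S := ℂ)
      (M := FreeMonoid (Fin m × ZMod T))).toLinearMap

open Classical in
theorem coeffWord_word (v w : List (Fin m × ZMod T)) :
    coeffWord v (word w) = if w = v then 1 else 0 := by
  change Finsupp.single (FreeMonoid.ofList w) (1 : ℂ) (FreeMonoid.ofList v) = _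
  rw [Finsupp.single_apply]
  congr 1

theorem wordAlgebra_induction {P : WordAlgebra m T → Prop} (x : WordAlgebra m T)
    (hword : ∀ w, P (word w)) (hadd : ∀ x y, P x → P y → P (x + y))
    (hsmul : ∀ (c : ℂ) (x), P x → P (c • x)) : P x :=
  MonoidAlgebra.induction_on x (fun w => hword (FreeMonoid.toList w)) hadd hsmul

/-- The words `x` with `S (letters x)` span this subspace. -/
def wordSpan (S : List (Fin m) → Prop) : Submodule ℂ (WordAlgebra m T) :=
  Submodule.span ℂ {f | ∃ x, S (letters x) ∧ f = word x}

theorem word_mem_wordSpan {S : List (Fin m) → Prop} {x : List (Fin m × ZMod T)}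
    (h : S (letters x)) : word x ∈ wordSpan S :=
  Submodule.subset_span ⟨x, h, rfl⟩

theorem wordSpan_mono {S S' : List (Fin m) → Prop} (h : ∀ l, S l → S' l) :
    wordSpan (T := T) S ≤ wordSpan S' :=
  Submodule.span_mono fun _ ⟨x, hx, e⟩ => ⟨x, h _ hx, e⟩

theorem mul_mem_wordSpan {S S' S'' : List (Fin m) → Prop}
    (h : ∀ l l', S l → S' l' → S'' (l ++ l')) {f g : WordAlgebra m T} (hf : f ∈ wordSpan S)
    (hg : g ∈ wordSpan S') : f * g ∈ wordSpan S'' := by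
  have hfg := Submodule.mul_mem_mul hf hg
  rw [wordSpan, wordSpan, Submodule.span_mul_span] at hfg
  refine Submodule.span_mono ?_ hfg
  rintro _ ⟨_, ⟨x, hx, rfl⟩, _, ⟨y, hy, rfl⟩, rfl⟩
  exact ⟨x ++ y, by rw [letters_append]; exact h _ _ hx hy, (word_append x y).symm⟩

theorem coeffWord_eq_zero {S : List (Fin m) → Prop} {f : WordAlgebra m T} (hf : f ∈ wordSpan S)
    {x : List (Fin m × ZMod T)} (hx : ¬ S (letters x)) : coeffWord x f = 0 := by
  classical
  induction hf using Submodule.span_induction with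
  | mem f hf =>
    obtain ⟨y, hy, rfl⟩ := hf
    rw [coeffWord_word, if_neg]
    rintro rfl
    exact hx hy
  | zero => exact map_zero _
  | add f g _ _ hf hg => rw [map_add, hf, hg, add_zero]
  | smul c f _ hf => rw [map_smul, hf, smul_zero]

/-- The words obtained by permuting the letters of `l`. -/
abbrev PermOf (l x : List (Fin m)) : Prop := x.Perm l

/-- The greater words obtained by permuting the letters of `l`. -/
abbrev Above (l x : List (Fin m)) : Prop := x.Perm l ∧ RevLex l x

/-- Equal lengths guarantee that the comparison is decided inside `l` and `x`, before the prepended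
letters are reached. -/
theorem RevLex.append_left {l x : List (Fin m)} (h : RevLex l x) (hl : l.length = x.length)
    (l' x' : List (Fin m)) : RevLex (l' ++ l) (x' ++ x) := by
  rw [RevLex, List.reverse_append, List.reverse_append]
  rw [RevLex] at h
  rw [← List.length_reverse, ← List.length_reverse (as := x)] at hl
  generalize l.reverse = a at h hl
  generalize x.reverse = b at h hl
  induction h with
  | nil => simp at hl
  | rel h => exact List.Lex.rel h
  | cons _ ih => exact List.Lex.cons (ih (by simpa using hl))

theorem RevLex.append_right {l x : List (Fin m)} (h : RevLex l x) (l' : List (Fin m)) :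
    RevLex (l ++ l') (x ++ l') := by
  rw [RevLex, List.reverse_append, List.reverse_append]
  exact List.append_left_lt h

/-- `P` is the leading part of `f`: it is a combination of words with underlying word `l`, and
`f - P` is a combination of greater words. -/
def HasLead (f P : WordAlgebra m T) (l : List (Fin m)) : Prop :=
  P ∈ wordSpan (fun x => x = l) ∧ f - P ∈ wordSpan (Above l)

theorem HasLead.mem_permOf {f P : WordAlgebra m T} {l : List (Fin m)} (h : HasLead f P l) :
    f ∈ wordSpan (PermOf l) := by
  rw [← sub_add_cancel f P]
  exact add_mem (wordSpan_mono (fun _ h => h.1) h.2)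
    (wordSpan_mono (fun x (h : x = l) => h ▸ List.Perm.refl _) h.1)

theorem HasLead.mul {f g P Q : WordAlgebra m T} {l l' : List (Fin m)} (hf : HasLead f P l)
    (hg : HasLead g Q l') : HasLead (f * g) (P * Q) (l ++ l') := by
  refine ⟨mul_mem_wordSpan (fun x y hx hy => by rw [hx, hy]) hf.1 hg.1, ?_⟩
  have h : f * g - P * Q = (f - P) * Q + f * (g - Q) := by noncomm_ring
  rw [h]
  refine add_mem (mul_mem_wordSpan ?_ hf.2 hg.1) (mul_mem_wordSpan ?_ hf.mem_permOf hg.2)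
  · rintro x y hx rfl
    exact ⟨hx.1.append_right _, hx.2.append_right _⟩
  · intro x y hx hy
    exact ⟨hx.append hy.1, hy.2.append_left hy.1.length_eq.symm _ _⟩

theorem HasLead.sub {f g P : WordAlgebra m T} {l : List (Fin m)} (hf : HasLead f P l)
    (hg : g ∈ wordSpan (Above l)) : HasLead (f - g) P l := by
  refine ⟨hf.1, ?_⟩
  rw [sub_right_comm]
  exact sub_mem hf.2 hg

theorem HasLead.sum {ι : Type} {s : Finset ι} {f P : ι → WordAlgebra m T} {l : List (Fin m)}
    (h : ∀ i ∈ s, HasLead (f i) (P i) l) : HasLead (∑ i ∈ s, f i) (∑ i ∈ s, P i) l := by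
  refine ⟨Submodule.sum_mem _ fun i hi => (h i hi).1, ?_⟩
  rw [← Finset.sum_sub_distrib]
  exact Submodule.sum_mem _ fun i hi => (h i hi).2

theorem hasLead_word (w : List (Fin m × ZMod T)) : HasLead (word w) (word w) (letters w) :=
  ⟨word_mem_wordSpan rfl, by rw [sub_self]; exact zero_mem _⟩

/-! ### Leading words of bracketings and of their products -/

/-- The embedding of the free Lie algebra into the free associative algebra. -/
def freeRep : FreeLie m T →ₗ⁅ℂ⁆ WordAlgebra m T :=
  FreeLieAlgebra.lift ℂ fun a => word [a]

theorem freeRep_gen (a : Fin m × ZMod T) : freeRep (gen a) = word [a] :=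
  FreeLieAlgebra.lift_of_apply _ _

/-- A decorated Lyndon word is the leading word of its bracketing. -/
theorem hasLead_bracketing {w : List (Fin m × ZMod T)} (hn : (letters w).Nodup)
    (hw : MinLast (letters w)) : HasLead (freeRep (bracketing w)) (word w) (letters w) := by
  refine lyndon_induction
    (P := fun w => HasLead (freeRep (bracketing w)) (word w) (letters w))
    (fun a => ?_) (fun u v _ hstd hu hv => ?_) w hn hw
  · rw [bracketing_singleton, freeRep_gen]
    exact hasLead_word _
  · rw [bracketing_append hstd, LieHom.map_lie, LieRing.of_associative_ring_bracket, word_append,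
      letters_append]
    -- The words of the opposite product end in a letter of `u`; all of these exceed the last letter
    -- of `v`, so such words lie above `uv`.
    refine (hu.mul hv).sub (mul_mem_wordSpan ?_ hv.mem_permOf hu.mem_permOf)
    intro y x hy hx
    refine ⟨(hy.append hx).trans List.perm_append_comm, ?_⟩
    obtain ⟨p, b, q, a, hp, hq, hab, hbp, -⟩ := hstd
    have hx0 : x ≠ [] := by
      rintro rfl
      have := hx.length_eq
      rw [hp] at this
      simp at this
    obtain ⟨x, c, rfl⟩ := (List.eq_nil_or_concat' x).resolve_left hx0
    have hc : c ∈ letters u := hx.mem_iff.1 (by simp)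
    have hac : a < c := by
      rw [hp] at hc
      simp only [List.mem_append, List.mem_singleton] at hc
      rcases hc with hc | rfl
      · exact hab.trans (hbp c hc)
      · exact hab
    rw [hq, RevLex, ← List.append_assoc, ← List.append_assoc, List.reverse_concat,
      List.reverse_concat]
    exact List.Lex.rel hac

/-- The representation of `U(nbar)` in the free associative algebra. -/
def nbarRep : UNbar m T →ₐ[ℂ] WordAlgebra m T :=
  UniversalEnvelopingAlgebra.lift ℂ (freeRep.comp (nbar m T).incl)

theorem nbarRep_ι (x : nbar m T) :
    nbarRep (UniversalEnvelopingAlgebra.ι ℂ x) = freeRep (x : FreeLie m T) :=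
  UniversalEnvelopingAlgebra.lift_ι_apply ℂ _ x

/-- The representation of `U(a)` in the free associative algebra. -/
def envRep : UFree m T →ₐ[ℂ] WordAlgebra m T :=
  UniversalEnvelopingAlgebra.lift ℂ freeRep

theorem envRep_ι (x : FreeLie m T) :
    envRep (UniversalEnvelopingAlgebra.ι ℂ x) = freeRep x :=
  UniversalEnvelopingAlgebra.lift_ι_apply ℂ _ x

variable [NeZero T]

/-- The leading part of the image of `lyndonProd`. -/
def leadProd (ws : List (List (Fin m × ZMod T))) : WordAlgebra m T :=
  (ws.map fun w => ∑ j : ZMod T, word (shiftWord j w)).prod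

theorem leadProd_cons (w : List (Fin m × ZMod T)) (ws : List (List (Fin m × ZMod T))) :
    leadProd (w :: ws) = (∑ j : ZMod T, word (shiftWord j w)) * leadProd ws := by
  rw [leadProd, List.map_cons, List.prod_cons]
  rfl

theorem hasLead_proj {w : List (Fin m × ZMod T)} (hn : (letters w).Nodup)
    (hw : MinLast (letters w)) :
    HasLead (freeRep (proj (bracketing w) : FreeLie m T)) (∑ j : ZMod T, word (shiftWord j w))
      (letters w) := by
  have h : freeRep (proj (bracketing w) : FreeLie m T) =
      ∑ j : ZMod T, freeRep (bracketing (shiftWord j w)) := by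
    simp only [proj, map_sum, shift_bracketing _ hn hw]
  rw [h]
  refine HasLead.sum fun j _ => ?_
  have := hasLead_bracketing (w := shiftWord j w) (by rwa [letters_shiftWord])
    (by rwa [letters_shiftWord])
  rwa [letters_shiftWord] at this

theorem hasLead_lyndonProd {ws : List (List (Fin m × ZMod T))}
    (hws : ∀ w ∈ ws, MinLast (letters w) ∧ (letters w).Nodup) :
    HasLead (nbarRep (lyndonProd ws)) (leadProd ws) (letters ws.flatten) := by
  induction ws with
  | nil =>
    change HasLead (nbarRep 1) 1 []
    rw [map_one]
    exact hasLead_word []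
  | cons w ws ih =>
    rw [lyndonProd_cons, leadProd_cons, map_mul, nbarRep_ι, List.flatten_cons, letters_append]
    exact (hasLead_proj (hws w (by simp)).2 (hws w (by simp)).1).mul
      (ih fun v hv => hws v (by simp [hv]))

open Classical in
omit [NeZero T] in
theorem coeffWord_append_mul {w w' : List (Fin m × ZMod T)} (hlen : w.length = w'.length)
    (x' : List (Fin m × ZMod T)) (Q : WordAlgebra m T) :
    coeffWord (w' ++ x') (word w * Q) = if w = w' then coeffWord x' Q else 0 := by
  induction Q using wordAlgebra_induction with
  | hword x =>
    rw [← word_append, coeffWord_word, coeffWord_word, ← ite_and]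
    refine if_congr ⟨fun h => List.append_inj h hlen, ?_⟩ rfl rfl
    rintro ⟨rfl, rfl⟩
    rfl
  | hadd x y hx hy =>
    rw [mul_add, map_add, map_add, hx, hy]
    split_ifs <;> simp
  | hsmul c x hx =>
    rw [mul_smul_comm, map_smul, map_smul, hx]
    split_ifs <;> simp

-- Of the shifts of a word whose last decoration is 0, only the trivial one again has last
-- decoration 0.
omit [NeZero T] in
theorem shiftWord_eq_iff {w w' : List (Fin m × ZMod T)} (hw : w ≠ [])
    (h : ∀ a ∈ w.getLast?, a.2 = 0) (h' : ∀ a ∈ w'.getLast?, a.2 = 0) (j : ZMod T) :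
    shiftWord j w = w' ↔ j = 0 ∧ w = w' := by
  have h0 : shiftWord 0 w = w := by simp [shiftWord]
  constructor
  · rintro rfl
    obtain ⟨x, a, rfl⟩ := (List.eq_nil_or_concat' w).resolve_left hw
    have ha : a.2 = 0 := h a (by simp)
    have hj : a.2 + j = 0 := h' (a.1, a.2 + j) (by simp [shiftWord])
    obtain rfl : j = 0 := by rwa [ha, zero_add] at hj
    exact ⟨rfl, h0.symm⟩
  · rintro ⟨rfl, rfl⟩
    exact h0

-- Equal underlying words give factors of equal lengths, so the coefficient is computed factor by
-- factor; each factor contributes through one shift only.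
open Classical in
theorem coeffWord_leadProd {ws ws' : List (List (Fin m × ZMod T))}
    (hws : ∀ w ∈ ws, IsDecoratedLyndon w) (hws' : ∀ w ∈ ws', IsDecoratedLyndon w)
    (h : ws.map letters = ws'.map letters) :
    coeffWord ws'.flatten (leadProd ws) = if ws = ws' then 1 else 0 := by
  induction ws generalizing ws' with
  | nil =>
    obtain rfl : ws' = [] := by simpa using h.symm
    rw [if_pos rfl]
    change coeffWord [] (word []) = 1
    rw [coeffWord_word, if_pos rfl]
  | cons w ws ih =>
    cases ws' with
    | nil => simp at h
    | cons w' ws' =>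
      rw [List.map_cons, List.map_cons, List.cons.injEq] at h
      have hw := hws w (by simp)
      have hw' := hws' w' (by simp)
      have hne : w ≠ [] := by
        rintro rfl
        exact hw.1.1 rfl
      have hlen : w.length = w'.length := by
        rw [← letters_length, h.1, letters_length]
      rw [leadProd_cons, List.flatten_cons, Finset.sum_mul, map_sum]
      have hterm : ∀ j : ZMod T, coeffWord (w' ++ ws'.flatten) (word (shiftWord j w) * leadProd ws)
          = if j = 0 then (if w = w' then coeffWord ws'.flatten (leadProd ws) else 0) else 0 := by
        intro j
        rw [coeffWord_append_mul (by rw [← letters_length, letters_shiftWord, letters_length, hlen]),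
          ← ite_and]
        exact if_congr (shiftWord_eq_iff hne hw.2 hw'.2 j) rfl rfl
      rw [Finset.sum_congr rfl fun j _ => hterm j, Finset.sum_ite_eq', if_pos (Finset.mem_univ _),
        ih (fun v hv => hws v (by simp [hv])) (fun v hv => hws' v (by simp [hv])) h.2, ← ite_and]
      exact if_congr (by rw [List.cons.injEq]) rfl rfl

end Leading

/-! ### Uniqueness of the factorization into Lyndon words, and linear independence -/

/-- Last letters increase along the factorization, so the first factor ends at the least letter of
the whole word. This letter occurs once and so fixes where the first factor stops. -/
theorem factorization_unique {m : ℕ} {L L' : List (List (Fin m))} (hL : ∀ l ∈ L, MinLast l)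
    (hL' : ∀ l ∈ L', MinLast l) (hs : L.Pairwise RevLex) (hs' : L'.Pairwise RevLex)
    (hn : L.flatten.Nodup) (h : L.flatten = L'.flatten) : L = L' := by
  have hmin : ∀ (x : List (Fin m)) (a : Fin m) (K : List (List (Fin m))), (∀ b ∈ x, a < b) →
      (∀ l ∈ K, MinLast l) → (∀ l ∈ K, RevLex (x ++ [a]) l) →
      ∀ b ∈ x ++ [a] ++ K.flatten, a ≤ b := by
    intro x a K hx hK hlt b hb
    simp only [List.mem_append, List.mem_singleton] at hb
    rcases hb with (hb | rfl) | hb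
    · exact (hx b hb).le
    · exact le_rfl
    · obtain ⟨l, hl, hbl⟩ := List.mem_flatten.1 hb
      obtain ⟨y, c, rfl, hy⟩ := hK l hl
      have h1 := hlt _ hl
      rw [RevLex, List.reverse_concat, List.reverse_concat] at h1
      have hac : a ≤ c := List.head_le_of_lt h1
      simp only [List.mem_append, List.mem_singleton] at hbl
      rcases hbl with hbl | rfl
      · exact hac.trans (hy b hbl).le
      · exact hac
  induction L generalizing L' with
  | nil =>
    cases L' with
    | nil => rfl
    | cons l' L' =>
      obtain ⟨x, a, rfl, -⟩ := hL' l' (by simp)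
      simp at h
  | cons l L ih =>
    cases L' with
    | nil =>
      obtain ⟨x, a, rfl, -⟩ := hL l (by simp)
      simp at h
    | cons l' L' =>
      obtain ⟨x, a, rfl, hx⟩ := hL l (by simp)
      obtain ⟨x', a', rfl, hx'⟩ := hL' l' (by simp)
      rw [List.pairwise_cons] at hs hs'
      rw [List.flatten_cons, List.flatten_cons] at h
      rw [List.flatten_cons] at hn
      have h1 := hmin x a L hx (fun l hl => hL l (by simp [hl])) hs.1
      have h2 := hmin x' a' L' hx' (fun l hl => hL' l (by simp [hl])) hs'.1
      obtain rfl : a = a' := le_antisymm (h1 a' (by rw [h]; simp)) (h2 a (by rw [← h]; simp))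
      have hn' := hn
      rw [h] at hn'
      have h3 : x ++ a :: L.flatten = x' ++ a :: L'.flatten := by simpa using h
      have hax : a ∉ x := fun ha => lt_irrefl _ (hx a ha)
      have hnL : L.flatten.Nodup := (List.nodup_append.1 hn).2.1
      have haL : a ∉ L.flatten := fun ha =>
        List.disjoint_of_nodup_append hn (a := a) (by simp) ha
      obtain ⟨rfl, -, hflat⟩ := (List.append_cons_inj_of_notMem hax haL).1 h3
      rw [ih (fun l hl => hL l (by simp [hl])) (fun l hl => hL' l (by simp [hl])) hs.2 hs'.2 hnL
        hflat]

/-- Vectors that are unitriangular with respect to a family of functionals are linearly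
independent. -/
theorem linearIndependent_of_triangular {ι κ V : Type*} [LinearOrder κ] [AddCommGroup V]
    [Module ℂ V] (v : ι → V) (φ : ι → V →ₗ[ℂ] ℂ) (ρ : ι → κ) (h1 : ∀ i, φ i (v i) = 1)
    (h0 : ∀ i j, j ≠ i → φ i (v j) ≠ 0 → ρ j < ρ i) : LinearIndependent ℂ v := by
  rw [linearIndependent_iff]
  intro l hl
  by_contra hne
  -- At an index of minimal `ρ` in the support, the functional `φ i` sees no other term.
  obtain ⟨i, hi, hmin⟩ := l.support.exists_min_image ρ (Finsupp.support_nonempty_iff.2 hne)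
  have h := congrArg (φ i) hl
  rw [Finsupp.linearCombination_apply, Finsupp.sum, map_sum, map_zero, Finset.sum_eq_single i] at h
  · rw [map_smul, h1, smul_eq_mul, mul_one] at h
    exact Finsupp.mem_support_iff.1 hi h
  · intro j hj hji
    rw [map_smul, smul_eq_mul]
    by_contra hne
    exact not_lt.2 (hmin j hj) (h0 i j hji (right_ne_zero_of_mul hne))
  · exact fun h => absurd hi h

section Triangular

variable {m T : ℕ} [NeZero T]

omit [NeZero T] in
theorem IsLabel.minLast {ws : List (List (Fin m × ZMod T))} (h : IsLabel ws)
    (hn : (letters ws.flatten).Nodup) :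
    ∀ w ∈ ws, MinLast (letters w) ∧ (letters w).Nodup := fun w hw =>
  ⟨(h.1 w hw).minLast (nodup_of_mem hn hw), nodup_of_mem hn hw⟩

omit [NeZero T] in
theorem IsLabel.map_letters_eq {ws ws' : List (List (Fin m × ZMod T))} (h : IsLabel ws)
    (h' : IsLabel ws') (hn : (letters ws.flatten).Nodup)
    (he : letters ws.flatten = letters ws'.flatten) : ws.map letters = ws'.map letters := by
  have hn' := he ▸ hn
  refine factorization_unique ?_ ?_ (List.pairwise_map.2 h.2) (List.pairwise_map.2 h'.2)
    (letters_flatten ws ▸ hn) (by rw [← letters_flatten, ← letters_flatten, he])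
  · intro l hl
    obtain ⟨w, hw, rfl⟩ := List.mem_map.1 hl
    exact (h.minLast hn w hw).1
  · intro l hl
    obtain ⟨w, hw, rfl⟩ := List.mem_map.1 hl
    exact (h'.minLast hn' w hw).1

theorem coeffWord_lyndonProd_self {ws : List (List (Fin m × ZMod T))} (h : IsLabel ws)
    (hn : (letters ws.flatten).Nodup) : coeffWord ws.flatten (nbarRep (lyndonProd ws)) = 1 := by
  classical
  have hlead := hasLead_lyndonProd (h.minLast hn)
  rw [← sub_add_cancel (nbarRep (lyndonProd ws)) (leadProd ws), map_add,
    coeffWord_eq_zero hlead.2 (fun hab => lt_irrefl _ hab.2), zero_add,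
    coeffWord_leadProd h.1 h.1 rfl, if_pos rfl]

/-- If the underlying words agree, only the leading part can contribute, and it separates different
labels; if they differ, only the greater words remain. -/
theorem lt_of_coeffWord_ne_zero {ws ws' : List (List (Fin m × ZMod T))} (h : IsLabel ws)
    (h' : IsLabel ws') (hn : (letters ws.flatten).Nodup) (hne : ws ≠ ws')
    (hc : coeffWord ws'.flatten (nbarRep (lyndonProd ws)) ≠ 0) :
    (letters ws.flatten).reverse < (letters ws'.flatten).reverse := by
  classical
  have hlead := hasLead_lyndonProd (h.minLast hn)
  rw [← sub_add_cancel (nbarRep (lyndonProd ws)) (leadProd ws), map_add] at hc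
  by_cases he : letters ws.flatten = letters ws'.flatten
  · rw [coeffWord_eq_zero hlead.2 (fun hab => lt_irrefl _ (he ▸ hab.2)), zero_add,
      coeffWord_leadProd h.1 h'.1 (h.map_letters_eq h' hn he), if_neg hne] at hc
    exact absurd rfl hc
  · rw [coeffWord_eq_zero hlead.1 (Ne.symm he), add_zero] at hc
    by_contra hlt
    exact hc (coeffWord_eq_zero hlead.2 fun hab => hlt hab.2)

end Triangular

/-! ### Counting the labels -/

section Count

variable {m T : ℕ}

theorem IsLabel.nil : IsLabel ([] : List (List (Fin m × ZMod T))) :=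
  ⟨by simp, List.Pairwise.nil⟩

/-- In a sequence of decorated Lyndon words in distinct letters, the first word ends with the least
of all letters. -/
theorem isLabel_cons_iff {w : List (Fin m × ZMod T)} {ws : List (List (Fin m × ZMod T))}
    (hn : (letters (w :: ws).flatten).Nodup) :
    IsLabel (w :: ws) ↔ IsLabel ws ∧ ∃ x a, w = x ++ [(a, (0 : ZMod T))] ∧
      ∀ b ∈ letters x ++ letters ws.flatten, a < b := by
  rw [List.flatten_cons, letters_append] at hn
  have hnw := (List.nodup_append'.1 hn).1
  have hnws := (List.nodup_append'.1 hn).2.1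
  have hdis := (List.nodup_append'.1 hn).2.2
  constructor
  · rintro ⟨hw, hp⟩
    rw [List.pairwise_cons] at hp
    refine ⟨⟨fun v hv => hw v (by simp [hv]), hp.2⟩, ?_⟩
    have hwl := hw w (by simp)
    have hne : w ≠ [] := by
      rintro rfl
      exact hwl.1.1 rfl
    obtain ⟨x, ⟨a, d⟩, rfl⟩ := (List.eq_nil_or_concat' w).resolve_left hne
    obtain rfl : d = 0 := hwl.2 (a, d) (by simp)
    obtain ⟨y, c, hyc, hy⟩ := hwl.minLast hnw
    obtain ⟨rfl, hac⟩ := List.append_inj' ((letters_append x [(a, 0)]).symm.trans hyc) rfl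
    obtain rfl : a = c := by simpa [letters] using hac
    refine ⟨x, a, rfl, fun b hb => ?_⟩
    rcases List.mem_append.1 hb with hb | hb
    · exact hy b hb
    · have hb' := hb
      rw [letters_flatten] at hb'
      obtain ⟨l, hl, hbl⟩ := List.mem_flatten.1 hb'
      obtain ⟨v, hv, rfl⟩ := List.mem_map.1 hl
      obtain ⟨z, e, hz, hze⟩ := (hw v (by simp [hv])).minLast (nodup_of_mem hnws hv)
      have h1 := hp.1 v hv
      rw [RevLex, hz, hyc, List.reverse_concat, List.reverse_concat] at h1
      have hae : a ≤ e := List.head_le_of_lt h1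
      have hab : a ≤ b := by
        rw [hz] at hbl
        simp only [List.mem_append, List.mem_singleton] at hbl
        rcases hbl with hbl | rfl
        · exact hae.trans (hze b hbl).le
        · exact hae
      refine lt_of_le_of_ne hab ?_
      rintro rfl
      exact hdis (a := a) (by rw [hyc]; simp) hb
  · rintro ⟨hws, x, a, rfl, ha⟩
    have hletters : letters (x ++ [(a, (0 : ZMod T))]) = letters x ++ [a] := letters_append _ _
    refine ⟨fun v hv => ?_, List.pairwise_cons.2 ⟨fun v hv => ?_, hws.2⟩⟩
    · rcases List.mem_cons.1 hv with rfl | hv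
      · refine ⟨?_, by simp⟩
        rw [hletters]
        exact MinLast.isLyndon ⟨letters x, a, rfl, fun b hb => ha b (by simp [hb])⟩
      · exact hws.1 v hv
    · obtain ⟨z, e, hz, -⟩ := (hws.1 v hv).minLast (nodup_of_mem hnws hv)
      rw [RevLex, hz, hletters, List.reverse_concat, List.reverse_concat]
      refine List.Lex.rel (ha e (List.mem_append_right _ ?_))
      rw [letters_flatten]
      exact List.mem_flatten.2 ⟨letters v, List.mem_map_of_mem hv, by rw [hz]; simp⟩

theorem cons_eq_val_iff {M : Multiset (Fin m)} {S : Finset (Fin m)} {a : Fin m} :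
    a ::ₘ M = S.val ↔ a ∈ S ∧ M = (S.erase a).val := by
  rw [Finset.erase_val]
  constructor
  · intro h
    refine ⟨?_, ?_⟩
    · rw [← Finset.mem_val, ← h]
      exact Multiset.mem_cons_self a M
    · rw [← h, Multiset.erase_cons_head]
  · rintro ⟨ha, rfl⟩
    exact Multiset.cons_erase ha

/-- Counting a set whose elements are sorted by their heads. -/
theorem card_union_biUnion {X J : Type} [DecidableEq X] {F : Finset X} {I : Finset J}
    {G : J → Finset X} {c : ℕ} (head : X → Option J) (hF : ∀ x ∈ F, ∀ j ∈ I, head x ≠ some j)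
    (hG : ∀ j ∈ I, ∀ x ∈ G j, head x = some j) (hc : ∀ j ∈ I, (G j).card = c) :
    (F ∪ I.biUnion G).card = F.card + I.card * c := by
  rw [Finset.card_union_of_disjoint, Finset.card_biUnion, Finset.sum_const_nat hc]
  · intro i hi j hj hij
    refine Finset.disjoint_left.2 fun x hx hx' => ?_
    exact hij (Option.some_injective _ ((hG i hi x hx).symm.trans (hG j hj x hx')))
  · rw [Finset.disjoint_left]
    intro x hx hx'
    obtain ⟨j, hj, hx'⟩ := Finset.mem_biUnion.1 hx'
    exact hF x hx j hj (hG j hj x hx')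

/-- Put a letter in front of the first word of a sequence. -/
def consHead (a : Fin m × ZMod T) : List (List (Fin m × ZMod T)) → List (List (Fin m × ZMod T))
  | [] => [[a]]
  | w :: ws => (a :: w) :: ws

theorem flatten_consHead (a : Fin m × ZMod T) (ws : List (List (Fin m × ZMod T))) :
    (consHead a ws).flatten = a :: ws.flatten := by
  cases ws <;> rfl

/-- The labels in which the letters are the elements of `S`. -/
def labelSet (T : ℕ) (S : Finset (Fin m)) : Set (List (List (Fin m × ZMod T))) :=
  {ws | IsLabel ws ∧ (letters ws.flatten : Multiset (Fin m)) = S.val}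

theorem nodup_of_coe_eq_val {l : List (Fin m)} {S : Finset (Fin m)}
    (h : (l : Multiset (Fin m)) = S.val) : l.Nodup :=
  Multiset.coe_nodup.1 (h ▸ S.nodup)

theorem ne_nil_of_mem_labelSet {S : Finset (Fin m)} {ws : List (List (Fin m × ZMod T))}
    (h : ws ∈ labelSet T S) (hS : S.Nonempty) : ws ≠ [] := by
  rintro rfl
  have : S.val = 0 := h.2.symm
  exact hS.ne_empty (Finset.val_eq_zero.1 this)

theorem singleton_cons_mem_labelSet {S : Finset (Fin m)} {a : Fin m} (ha : a ∈ S)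
    (hmin : ∀ b ∈ S, a ≤ b) {ws : List (List (Fin m × ZMod T))}
    (h : ws ∈ labelSet T (S.erase a)) : [(a, 0)] :: ws ∈ labelSet T S := by
  have hval : (letters ([(a, (0 : ZMod T))] :: ws).flatten : Multiset (Fin m)) = S.val :=
    cons_eq_val_iff.2 ⟨ha, h.2⟩
  refine ⟨(isLabel_cons_iff (nodup_of_coe_eq_val hval)).2 ⟨h.1, [], a, rfl, fun b hb => ?_⟩, hval⟩
  have hb' : b ∈ S.erase a := by
    rw [← Finset.mem_val, ← h.2]
    exact hb
  rw [Finset.mem_erase] at hb'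
  exact lt_of_le_of_ne (hmin b hb'.2) hb'.1.symm

/-- The least letter `a₀` survives in `S.erase a` and ends the first word, so putting `a > a₀` in
front keeps that word Lyndon and the sequence increasing. -/
theorem consHead_mem_labelSet {S : Finset (Fin m)} {a₀ a : Fin m} (ha₀ : a₀ ∈ S)
    (hmin : ∀ b ∈ S, a₀ ≤ b) (ha : a ∈ S.erase a₀) (d : ZMod T)
    {ws : List (List (Fin m × ZMod T))} (h : ws ∈ labelSet T (S.erase a)) :
    consHead (a, d) ws ∈ labelSet T S := by
  rw [Finset.mem_erase] at ha
  have ha₀' : a₀ ∈ S.erase a := Finset.mem_erase.2 ⟨ha.1.symm, ha₀⟩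
  have hval : (letters (consHead (a, d) ws).flatten : Multiset (Fin m)) = S.val := by
    rw [flatten_consHead]
    exact cons_eq_val_iff.2 ⟨ha.2, h.2⟩
  cases ws with
  | nil => exact absurd rfl (ne_nil_of_mem_labelSet h ⟨a₀, ha₀'⟩)
  | cons w ws =>
    obtain ⟨hws, x, c, rfl, hc⟩ := (isLabel_cons_iff (nodup_of_coe_eq_val h.2)).1 h.1
    have hmem : ∀ b ∈ S.erase a, b = c ∨ c < b := by
      intro b hb
      rw [← Finset.mem_val, ← h.2, Multiset.mem_coe, List.flatten_cons, letters_append,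
        letters_append, List.append_assoc] at hb
      simp only [List.mem_append] at hb hc
      rcases hb with hb | hb | hb
      · exact Or.inr (hc b (Or.inl hb))
      · exact Or.inl (by simpa [letters] using hb)
      · exact Or.inr (hc b (Or.inr hb))
    have hca : c < a := by
      refine lt_of_le_of_lt ?_ (lt_of_le_of_ne (hmin a ha.2) ha.1.symm)
      rcases hmem a₀ ha₀' with h | h
      · exact h.ge
      · exact h.le
    refine ⟨(isLabel_cons_iff (nodup_of_coe_eq_val hval)).2
      ⟨hws, (a, d) :: x, c, rfl, fun b hb => ?_⟩, hval⟩
    rcases List.mem_cons.1 hb with rfl | hb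
    · exact hca
    · exact hc b hb

/-- The first word ends in the undecorated least letter `a₀`; either it is that letter alone, or it
has a decorated first letter to strip. -/
theorem mem_labelSet_cases {S : Finset (Fin m)} {a₀ : Fin m} (hmin : ∀ b ∈ S, a₀ ≤ b)
    (ha₀ : a₀ ∈ S) {ws : List (List (Fin m × ZMod T))} (h : ws ∈ labelSet T S) :
    (∃ vs ∈ labelSet T (S.erase a₀), [(a₀, 0)] :: vs = ws) ∨
      ∃ a ∈ S.erase a₀, ∃ (d : ZMod T), ∃ vs ∈ labelSet T (S.erase a), consHead (a, d) vs = ws := by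
  cases ws with
  | nil => exact absurd rfl (ne_nil_of_mem_labelSet h ⟨a₀, ha₀⟩)
  | cons w ws =>
    obtain ⟨hws, x, c, rfl, hc⟩ := (isLabel_cons_iff (nodup_of_coe_eq_val h.2)).1 h.1
    have hmem : ∀ b, b ∈ S ↔ b ∈ letters x ∨ b = c ∨ b ∈ letters ws.flatten := by
      intro b
      rw [← Finset.mem_val, ← h.2, Multiset.mem_coe, List.flatten_cons, letters_append,
        letters_append, List.append_assoc]
      simp [letters]
    have hca : c = a₀ := by
      refine le_antisymm ?_ (hmin c ((hmem c).2 (Or.inr (Or.inl rfl))))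
      rcases (hmem a₀).1 ha₀ with h | h | h
      · exact (hc _ (List.mem_append_left _ h)).le
      · exact h.ge
      · exact (hc _ (List.mem_append_right _ h)).le
    subst hca
    cases x with
    | nil =>
      have hval : c ::ₘ (letters ws.flatten : Multiset (Fin m)) = S.val := h.2
      exact Or.inl ⟨ws, ⟨hws, (cons_eq_val_iff.1 hval).2⟩, rfl⟩
    | cons p x =>
      obtain ⟨a, d⟩ := p
      have hS : a ::ₘ (letters ((x ++ [(c, (0 : ZMod T))]) :: ws).flatten : Multiset (Fin m)) =
        S.val := h.2
      have hval := (cons_eq_val_iff.1 hS).2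
      have hca : c < a := hc a (by simp [letters])
      refine Or.inr ⟨a, Finset.mem_erase.2 ⟨hca.ne', (cons_eq_val_iff.1 hS).1⟩, d,
        (x ++ [(c, 0)]) :: ws, ⟨?_, hval⟩, rfl⟩
      refine (isLabel_cons_iff (nodup_of_coe_eq_val hval)).2 ⟨hws, x, c, rfl, fun b hb => hc b ?_⟩
      exact List.mem_cons_of_mem a hb

/-- `1 (1 + N T) (1 + (N + 1) T) ⋯`. -/
def labelCount (N T n : ℕ) : ℕ := ∏ k ∈ Finset.range n, (1 + (k + N) * T)

theorem labelCount_zero_succ (T n : ℕ) :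
    labelCount 0 T (n + 1) = labelCount 0 T n + n * T * labelCount 0 T n := by
  rw [labelCount, Finset.prod_range_succ, ← labelCount]
  ring

theorem labelCount_succ_succ (N T n : ℕ) :
    labelCount (N + 1) T (n + 1) =
      labelCount N T (n + 1) + (n + 1) * T * labelCount (N + 1) T n := by
  have h : labelCount N T (n + 1) = labelCount (N + 1) T n * (1 + N * T) := by
    rw [labelCount, Finset.prod_range_succ', labelCount]
    congr 1
    · exact Finset.prod_congr rfl fun k _ => by ring
    · ring
  rw [h, labelCount, Finset.prod_range_succ, ← labelCount]
  ring

/-- With `n + 1` letters, stripping the first letter leaves a label on `n` letters. The least letter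
can be stripped with decoration 0 only, each of the other `n` with any of `T` decorations: a factor
`1 + n T`. -/
theorem exists_finset_labelSet [NeZero T] (S : Finset (Fin m)) :
    ∃ F : Finset (List (List (Fin m × ZMod T))), (∀ ws, ws ∈ F ↔ ws ∈ labelSet T S) ∧
      F.card = labelCount 0 T S.card := by
  classical
  induction hn : S.card generalizing S with
  | zero =>
    obtain rfl := Finset.card_eq_zero.1 hn
    refine ⟨{[]}, fun ws => ?_, rfl⟩
    rw [Finset.mem_singleton]
    constructor
    · rintro rfl
      exact ⟨IsLabel.nil, rfl⟩
    · rintro ⟨h, h'⟩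
      cases ws with
      | nil => rfl
      | cons w ws =>
        have hw := h.1 w (by simp)
        rw [Finset.empty_val, Multiset.coe_eq_zero, List.flatten_cons, letters_append,
          List.append_eq_nil_iff] at h'
        exact absurd h'.1 hw.1.1
  | succ n ih =>
    have hne : S.Nonempty := Finset.card_pos.1 (by omega)
    obtain ⟨a₀, ha₀, hmin⟩ := S.exists_min_image id hne
    have hcard : ∀ a ∈ S, (S.erase a).card = n := fun a ha => by
      rw [Finset.card_erase_of_mem ha, hn]; rfl
    have hex : ∀ a, ∃ F : Finset (List (List (Fin m × ZMod T))), a ∈ S →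
        (∀ ws, ws ∈ F ↔ ws ∈ labelSet T (S.erase a)) ∧ F.card = labelCount 0 T n := fun a => by
      by_cases ha : a ∈ S
      · obtain ⟨F, hF⟩ := ih (S.erase a) (hcard a ha)
        exact ⟨F, fun _ => hF⟩
      · exact ⟨∅, fun h => absurd h ha⟩
    choose F hF using hex
    refine ⟨(F a₀).image (fun ws => [(a₀, 0)] :: ws) ∪
      ((S.erase a₀) ×ˢ (Finset.univ : Finset (ZMod T))).biUnion
        fun a => (F a.1).image (consHead a), fun ws => ?_, ?_⟩
    · simp only [Finset.mem_union, Finset.mem_image, Finset.mem_biUnion, Finset.mem_product,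
        Finset.mem_univ, and_true]
      constructor
      · rintro (⟨vs, hvs, rfl⟩ | ⟨⟨a, d⟩, ha, vs, hvs, rfl⟩)
        · exact singleton_cons_mem_labelSet ha₀ hmin (((hF a₀ ha₀).1 vs).1 hvs)
        · exact consHead_mem_labelSet ha₀ hmin ha d
            (((hF a (Finset.mem_of_mem_erase ha)).1 vs).1 hvs)
      · intro h
        rcases mem_labelSet_cases hmin ha₀ h with ⟨vs, hvs, rfl⟩ | ⟨a, ha, d, vs, hvs, rfl⟩
        · exact Or.inl ⟨vs, ((hF a₀ ha₀).1 vs).2 hvs, rfl⟩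
        · exact Or.inr ⟨(a, d), ha, vs,
            ((hF a (Finset.mem_of_mem_erase ha)).1 vs).2 hvs, rfl⟩
    -- The first decorated letter of the concatenation tells the pieces of the union apart.
    · rw [card_union_biUnion (c := labelCount 0 T n) (fun ws => ws.flatten.head?),
        Finset.card_image_of_injective _ (fun _ _ h => (List.cons.inj h).2), (hF a₀ ha₀).2,
        Finset.card_product, hcard a₀ ha₀, Finset.card_univ, ZMod.card, labelCount_zero_succ]
      · simp only [Finset.mem_image, Finset.mem_product, Finset.mem_erase]
        rintro _ ⟨vs, -, rfl⟩ j hj h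
        have : (a₀, (0 : ZMod T)) = j := Option.some_injective _ h
        exact hj.1.1 (congrArg Prod.fst this).symm
      · intro a _ ws hws
        obtain ⟨vs, -, rfl⟩ := Finset.mem_image.1 hws
        simp [flatten_consHead]
      · intro a ha
        rw [Finset.mem_product] at ha
        have haS := Finset.mem_of_mem_erase ha.1
        rw [Finset.card_image_of_injOn, (hF a.1 haS).2]
        -- `consHead` confuses `[]` with `[[]]`; it is injective here because labels on a nonempty
        -- set of letters are nonempty sequences.
        have hne' : (S.erase a.1).Nonempty :=
          ⟨a₀, Finset.mem_erase.2 ⟨(Finset.mem_erase.1 ha.1).1.symm, ha₀⟩⟩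
        intro vs hvs vs' hvs' h
        have h1 := ne_nil_of_mem_labelSet (((hF a.1 haS).1 vs).1 hvs) hne'
        have h2 := ne_nil_of_mem_labelSet (((hF a.1 haS).1 vs').1 hvs') hne'
        cases vs with
        | nil => exact absurd rfl h1
        | cons v vs =>
          cases vs' with
          | nil => exact absurd rfl h2
          | cons v' vs' =>
            change (a :: v) :: vs = (a :: v') :: vs' at h
            simpa using h

/-! ### Counting the labels for the tensor product -/

/-- The labels of the basis of a weight subspace of `M_{0,N}`: a label for `U(nbar)` and `N` words,
such that the elements of `S` are the letters that occur. -/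
def moduleLabelSet (T N : ℕ) (S : Finset (Fin m)) :
    Set (List (List (Fin m × ZMod T)) × (Fin N → List (Fin m × ZMod T))) :=
  {p | IsLabel p.1 ∧ (letters p.1.flatten : Multiset (Fin m)) +
    ∑ s, (letters (p.2 s) : Multiset (Fin m)) = S.val}

/-- Put a letter in front of the first of the `N + 1` words. -/
def consWord {N : ℕ} (a : Fin m × ZMod T)
    (p : List (List (Fin m × ZMod T)) × (Fin (N + 1) → List (Fin m × ZMod T))) :
    List (List (Fin m × ZMod T)) × (Fin (N + 1) → List (Fin m × ZMod T)) :=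
  (p.1, Fin.cons (a :: p.2 0) (Fin.tail p.2))

theorem nil_mem_moduleLabelSet_iff {N : ℕ} {S : Finset (Fin m)}
    {ws : List (List (Fin m × ZMod T))} {ps : Fin N → List (Fin m × ZMod T)} :
    (ws, (Fin.cons [] ps : Fin (N + 1) → List (Fin m × ZMod T))) ∈ moduleLabelSet T (N + 1) S ↔
      (ws, ps) ∈ moduleLabelSet T N S := by
  simp only [moduleLabelSet, Set.mem_ofPred_eq, Fin.sum_univ_succ, Fin.cons_zero, Fin.cons_succ]
  rw [show ((letters ([] : List (Fin m × ZMod T)) : List (Fin m)) : Multiset (Fin m)) = 0 from rfl,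
    zero_add]

theorem consWord_mem_moduleLabelSet_iff {N : ℕ} {S : Finset (Fin m)} {a : Fin m × ZMod T}
    {p : List (List (Fin m × ZMod T)) × (Fin (N + 1) → List (Fin m × ZMod T))} :
    consWord a p ∈ moduleLabelSet T (N + 1) S ↔
      a.1 ∈ S ∧ p ∈ moduleLabelSet T (N + 1) (S.erase a.1) := by
  have h : (letters (a :: p.2 0) : Multiset (Fin m)) = a.1 ::ₘ letters (p.2 0) := rfl
  simp only [moduleLabelSet, Set.mem_ofPred_eq, Fin.sum_univ_succ, consWord, Fin.cons_zero,
    Fin.cons_succ, h, Multiset.cons_add, Multiset.add_cons, cons_eq_val_iff]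
  exact and_left_comm

theorem consWord_injective {N : ℕ} (a : Fin m × ZMod T) :
    Function.Injective (consWord (N := N) a) := by
  intro p q h
  rw [consWord, consWord, Prod.mk.injEq, Fin.cons_inj, List.cons.injEq] at h
  refine Prod.ext h.1 ?_
  rw [← Fin.cons_self_tail p.2, ← Fin.cons_self_tail q.2, h.2.1.2, h.2.2]

/-- The first of the `N + 1` words is empty, which is the case of `N` words, or begins with one of
the `n T` decorated letters, which can be stripped. Nothing constrains a word in `U(a)`, so
stripping is a bijection. -/
theorem exists_finset_moduleLabelSet [NeZero T] (N : ℕ) (S : Finset (Fin m)) :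
    ∃ F : Finset (List (List (Fin m × ZMod T)) × (Fin N → List (Fin m × ZMod T))),
      (∀ p, p ∈ F ↔ p ∈ moduleLabelSet T N S) ∧ F.card = labelCount N T S.card := by
  classical
  induction N generalizing S with
  | zero =>
    obtain ⟨F, hF, hc⟩ := exists_finset_labelSet (T := T) S
    refine ⟨F.image fun ws => (ws, Fin.elim0), fun p => ?_, ?_⟩
    · obtain ⟨ws, ps⟩ := p
      obtain rfl : ps = Fin.elim0 := Subsingleton.elim _ _
      simp only [Finset.mem_image, Prod.mk.injEq, and_true, exists_eq_right, hF]
      simp [labelSet, moduleLabelSet]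
    · rw [Finset.card_image_of_injective _ (fun _ _ h => (Prod.mk.inj h).1), hc]
  | succ N ihN =>
    induction hn : S.card using Nat.strong_induction_on generalizing S with
    | _ n ih =>
    obtain ⟨F₀, hF₀, hc₀⟩ := ihN S
    have hex : ∀ a, ∃ F : Finset (List (List (Fin m × ZMod T)) ×
        (Fin (N + 1) → List (Fin m × ZMod T))), a ∈ S →
        (∀ p, p ∈ F ↔ p ∈ moduleLabelSet T (N + 1) (S.erase a)) ∧
          F.card = labelCount (N + 1) T (n - 1) := fun a => by
      by_cases ha : a ∈ S
      · have hpos := Finset.card_pos.2 ⟨a, ha⟩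
        obtain ⟨F, hF⟩ := ih (n - 1) (by omega) (S.erase a)
          (by rw [Finset.card_erase_of_mem ha, hn])
        exact ⟨F, fun _ => hF⟩
      · exact ⟨∅, fun h => absurd h ha⟩
    choose F hF using hex
    refine ⟨F₀.image (fun p => (p.1, (Fin.cons [] p.2 : Fin (N + 1) → List (Fin m × ZMod T)))) ∪
      (S ×ˢ (Finset.univ : Finset (ZMod T))).biUnion fun a => (F a.1).image (consWord a),
      fun p => ?_, ?_⟩
    · simp only [Finset.mem_union, Finset.mem_image, Finset.mem_biUnion, Finset.mem_product,
        Finset.mem_univ, and_true]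
      constructor
      · rintro (⟨q, hq, rfl⟩ | ⟨a, ha, q, hq, rfl⟩)
        · exact nil_mem_moduleLabelSet_iff.2 ((hF₀ q).1 hq)
        · exact consWord_mem_moduleLabelSet_iff.2 ⟨ha, ((hF a.1 ha).1 q).1 hq⟩
      · intro h
        obtain ⟨ws, ps⟩ := p
        induction ps using Fin.consCases with
        | _ x ps =>
        cases x with
        | nil => exact Or.inl ⟨(ws, ps), (hF₀ _).2 (nil_mem_moduleLabelSet_iff.1 h), rfl⟩
        | cons a x =>
          have he : consWord a (ws, (Fin.cons x ps : Fin (N + 1) → List (Fin m × ZMod T))) =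
              (ws, Fin.cons (a :: x) ps) := by
            simp [consWord]
          rw [← he] at h ⊢
          obtain ⟨ha, hq⟩ := consWord_mem_moduleLabelSet_iff.1 h
          exact Or.inr ⟨a, ha, _, ((hF a.1 ha).1 _).2 hq, rfl⟩
    · rw [card_union_biUnion (c := labelCount (N + 1) T (n - 1)) (fun p => (p.2 0).head?),
        Finset.card_image_of_injective, hc₀, Finset.card_product, Finset.card_univ, ZMod.card, hn]
      -- For `n = 0` no letter can be stripped, so the truncated value of `n - 1` is multiplied by
      -- 0.
      · cases n with
        | zero => rw [zero_mul, zero_mul, add_zero]; rfl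
        | succ n => rw [labelCount_succ_succ]; rfl
      · rintro ⟨ws, ps⟩ ⟨ws', ps'⟩ h
        simpa [Fin.cons_inj] using h
      · intro p hp j _ h
        obtain ⟨q, -, rfl⟩ := Finset.mem_image.1 hp
        simp at h
      · intro a _ p hp
        obtain ⟨q, -, rfl⟩ := Finset.mem_image.1 hp
        rfl
      · intro a ha
        rw [Finset.mem_product] at ha
        rw [Finset.card_image_of_injective _ (consWord_injective a), (hF a.1 ha.1).2]

end Count

/-! ### Bases of the weight subspaces -/

theorem coe_eq_univ_val_iff {m : ℕ} {M : Multiset (Fin m)} :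
    M = (Finset.univ : Finset (Fin m)).val ↔ ∀ i, M.count i = 1 := by
  have h : ∀ i : Fin m, (Finset.univ : Finset (Fin m)).val.count i = 1 := fun i =>
    Multiset.count_eq_one_of_mem Finset.univ.nodup (Finset.mem_univ i)
  constructor
  · rintro rfl
    exact h
  · intro hM
    ext i
    rw [hM, h]

section NBar

variable {m T : ℕ} [NeZero T]

omit [NeZero T] in
theorem lyndonLabel_iff {ws : List (List (Fin m × ZMod T))} :
    ((∀ w ∈ ws, IsDecoratedLyndon w) ∧
      ws.Pairwise (fun v w => RevLex (letters v) (letters w)) ∧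
        ∀ i : Fin m, (letters ws.flatten).count i = 1) ↔ ws ∈ labelSet T Finset.univ := by
  rw [labelSet, Set.mem_ofPred_eq, coe_eq_univ_val_iff, IsLabel, and_assoc]
  simp only [Multiset.coe_count]

theorem linearIndependent_lyndonElement :
    LinearIndependent ℂ (lyndonElement (m := m) (T := T)) := by
  have hlab : ∀ ws : LyndonLabel m T, IsLabel ws.1 := fun ws => ⟨ws.2.1, ws.2.2.1⟩
  have hn : ∀ ws : LyndonLabel m T, (letters ws.1.flatten).Nodup := fun ws =>
    List.nodup_iff_count_le_one.2 fun i => (ws.2.2.2 i).le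
  refine linearIndependent_of_triangular _
    (fun ws => coeffWord ws.1.flatten ∘ₗ nbarRep.toLinearMap)
    (fun ws => (letters ws.1.flatten).reverse) (fun ws => ?_) (fun ws ws' hne hc => ?_)
  · exact coeffWord_lyndonProd_self (hlab ws) (hn ws)
  · exact lt_of_coeffWord_ne_zero (hlab ws') (hlab ws) (hn ws')
      (fun h => hne (Subtype.ext h)) hc

theorem span_lyndonElement :
    Submodule.span ℂ (Set.range (lyndonElement (m := m) (T := T))) = uNbarWeight (ones m) := by
  rw [uNbarWeight_eq_labelSpan le_rfl, labelSpan]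
  congr 1
  ext u
  constructor
  · rintro ⟨ws, rfl⟩
    exact ⟨ws.1, ⟨ws.2.1, ws.2.2.1⟩, funext ws.2.2.2, rfl⟩
  · rintro ⟨ws, h, hc, rfl⟩
    exact ⟨⟨ws, h.1, h.2, congrFun hc⟩, rfl⟩

theorem finrank_uNbarWeight :
    Module.finrank ℂ (uNbarWeight (T := T) (ones m)) = labelCount 0 T m := by
  obtain ⟨F, hF, hcard⟩ := exists_finset_labelSet (T := T) (Finset.univ : Finset (Fin m))
  let _ : Fintype (LyndonLabel m T) := Fintype.subtype F fun ws => (hF ws).trans lyndonLabel_iff.symm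
  have h : Fintype.card (LyndonLabel m T) = F.card :=
    Fintype.subtype_card F fun ws => (hF ws).trans lyndonLabel_iff.symm
  rw [← span_lyndonElement, finrank_span_eq_card linearIndependent_lyndonElement, h, hcard,
    Finset.card_univ, Fintype.card_fin]

end NBar

section TensorProducts

attribute [local instance] LieRing.ofAssociativeRing

variable {m T N : ℕ}

/-! ### Words in the envelope of the free Lie algebra -/

/-- A word as an element of the envelope of the free Lie algebra. -/
def envWord (w : List (Fin m × ZMod T)) : UFree m T :=
  (w.map fun a => UniversalEnvelopingAlgebra.ι ℂ (gen a)).prod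

theorem envWord_append (u v : List (Fin m × ZMod T)) :
    envWord (u ++ v) = envWord u * envWord v := by
  rw [envWord, List.map_append, List.prod_append]
  rfl

theorem envWord_singleton (a : Fin m × ZMod T) :
    envWord [a] = UniversalEnvelopingAlgebra.ι ℂ (gen a) := by
  rw [envWord, List.map_singleton, List.prod_singleton]

theorem envRep_envWord (w : List (Fin m × ZMod T)) : envRep (envWord w) = word w := by
  induction w with
  | nil => exact map_one envRep
  | cons a w ih =>
    rw [← List.singleton_append, envWord_append, word_append, map_mul, ih, envWord_singleton,
      envRep_ι, freeRep_gen]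

variable (T) in
/-- The span of the words of given content. -/
def envWordSpan (r : Fin m → ℕ) : Submodule ℂ (UFree m T) :=
  Submodule.span ℂ {u | ∃ w, content w = r ∧ u = envWord w}

theorem envWord_mem (w : List (Fin m × ZMod T)) : envWord w ∈ envWordSpan T (content w) :=
  Submodule.subset_span ⟨w, rfl, rfl⟩

theorem mul_mem_envWordSpan {r s : Fin m → ℕ} {u v : UFree m T} (hu : u ∈ envWordSpan T r)
    (hv : v ∈ envWordSpan T s) : u * v ∈ envWordSpan T (r + s) := by
  have h := Submodule.mul_mem_mul hu hv
  rw [envWordSpan, envWordSpan, Submodule.span_mul_span] at h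
  refine Submodule.span_mono ?_ h
  rintro _ ⟨_, ⟨x, rfl, rfl⟩, _, ⟨y, rfl, rfl⟩, rfl⟩
  exact ⟨x ++ y, content_append x y, (envWord_append x y).symm⟩

theorem HasContent.ι_mem_envWordSpan {g : FreeLie m T} {r : Fin m → ℕ} (h : HasContent g r) :
    UniversalEnvelopingAlgebra.ι ℂ g ∈ envWordSpan T r := by
  induction h with
  | gen a =>
    rw [← envWord_singleton, ← content_singleton]
    exact envWord_mem _
  | lie _ _ ih ih' =>
    rw [LieHom.map_lie, LieRing.of_associative_ring_bracket]
    refine sub_mem (mul_mem_envWordSpan ih ih') ?_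
    rw [add_comm]
    exact mul_mem_envWordSpan ih' ih

/-- In the envelope an iterated commutator expands into products of generators of the same content.
-/
theorem uFreeWeight_eq (r : Fin m → ℕ) : uFreeWeight r = envWordSpan T r := by
  apply le_antisymm
  · refine Submodule.span_le.2 ?_
    rintro _ ⟨l, hl, rfl, rfl⟩
    induction l with
    | nil => exact envWord_mem []
    | cons p l ih =>
      rw [List.map_cons, List.map_cons, List.prod_cons, List.sum_cons]
      refine mul_mem_envWordSpan ?_ (ih fun q hq => hl q (by simp [hq]))
      have hp := Submodule.mem_map_of_mem
        (f := (UniversalEnvelopingAlgebra.ι ℂ : FreeLie m T →ₗ⁅ℂ⁆ UFree m T).toLinearMap)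
        (hl p (by simp))
      rw [weight, Submodule.map_span] at hp
      refine Submodule.span_le.2 ?_ hp
      rintro _ ⟨g, hg, rfl⟩
      exact HasContent.ι_mem_envWordSpan hg
  · refine Submodule.span_le.2 ?_
    rintro _ ⟨w, rfl, rfl⟩
    refine Submodule.subset_span ⟨w.map fun a => (Pi.single a.1 1, gen a), ?_, ?_, ?_⟩
    · intro p hp
      obtain ⟨a, -, rfl⟩ := List.mem_map.1 hp
      exact Submodule.subset_span (HasContent.gen a)
    · induction w with
      | nil => rfl
      | cons a w ih => rw [List.map_cons, List.map_cons, List.sum_cons, ih, content_cons]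
    · rw [List.map_map]
      rfl

/-- The value of a multilinear map on spans. -/
theorem multilinearMap_mem_span {ι : Type*} [Fintype ι] {M : ι → Type*} {V : Type*}
    [∀ i, AddCommGroup (M i)] [∀ i, Module ℂ (M i)] [AddCommGroup V] [Module ℂ V]
    (f : MultilinearMap ℂ M V) {A : ∀ i, Set (M i)} {v : ∀ i, M i}
    (hv : ∀ i, v i ∈ Submodule.span ℂ (A i)) :
    f v ∈ Submodule.span ℂ {y | ∃ a : ∀ i, M i, (∀ i, a i ∈ A i) ∧ y = f a} := by
  classical
  -- The finite set `t` records the arguments not yet replaced by generators; the induction expands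
  -- one of them at a time.
  suffices h : ∀ (t : Finset ι) (v : ∀ i, M i), (∀ i ∈ t, v i ∈ Submodule.span ℂ (A i)) →
      (∀ i ∉ t, v i ∈ A i) →
      f v ∈ Submodule.span ℂ {y | ∃ a : ∀ i, M i, (∀ i, a i ∈ A i) ∧ y = f a} from
    h Finset.univ v (fun i _ => hv i) (fun i hi => absurd (Finset.mem_univ i) hi)
  intro t
  induction t using Finset.induction_on with
  | empty => exact fun v _ h => Submodule.subset_span ⟨v, fun i => h i (by simp), rfl⟩
  | insert j t hj ih =>
    intro v h1 h2
    suffices h : ∀ x ∈ Submodule.span ℂ (A j), f (Function.update v j x) ∈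
        Submodule.span ℂ {y | ∃ a : ∀ i, M i, (∀ i, a i ∈ A i) ∧ y = f a} by
      have := h (v j) (h1 j (Finset.mem_insert_self j t))
      rwa [Function.update_eq_self] at this
    intro x hx
    induction hx using Submodule.span_induction with
    | mem x hx =>
      refine ih _ (fun i hi => ?_) (fun i hi => ?_)
      · have hij : i ≠ j := fun h => hj (h ▸ hi)
        rw [Function.update_of_ne hij]
        exact h1 i (Finset.mem_insert_of_mem hi)
      · by_cases hij : i = j
        · subst hij
          rwa [Function.update_self]
        · rw [Function.update_of_ne hij]
          exact h2 i (by simp [hij, hi])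
    | zero => rw [f.map_update_zero]; exact zero_mem _
    | add x y _ _ hx hy => rw [f.map_update_add]; exact add_mem hx hy
    | smul c x _ hx => rw [f.map_update_smul]; exact Submodule.smul_mem _ _ hx

variable [NeZero T]

/-- The tensor product of a product of projected bracketings and `N` words. -/
def moduleElement (p : List (List (Fin m × ZMod T)) × (Fin N → List (Fin m × ZMod T))) :
    ModuleM m T N :=
  lyndonProd p.1 ⊗ₜ[ℂ] PiTensorProduct.tprod ℂ fun s => envWord (p.2 s)

/-- The product of the coefficients of given words in the tensor factors. -/
def moduleCoeff (w : List (Fin m × ZMod T)) (ps : Fin N → List (Fin m × ZMod T)) :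
    ModuleM m T N →ₗ[ℂ] ℂ :=
  LinearMap.mul' ℂ ℂ ∘ₗ TensorProduct.map (coeffWord w ∘ₗ nbarRep.toLinearMap)
    (PiTensorProduct.lift ((MultilinearMap.mkPiAlgebra ℂ (Fin N) ℂ).compLinearMap
      fun s => coeffWord (ps s) ∘ₗ envRep.toLinearMap))

open Classical in
theorem moduleCoeff_moduleElement (w : List (Fin m × ZMod T))
    (ps : Fin N → List (Fin m × ZMod T))
    (p : List (List (Fin m × ZMod T)) × (Fin N → List (Fin m × ZMod T))) :
    moduleCoeff w ps (moduleElement p) =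
      if p.2 = ps then coeffWord w (nbarRep (lyndonProd p.1)) else 0 := by
  have h : moduleCoeff w ps (moduleElement p) =
      coeffWord w (nbarRep (lyndonProd p.1)) *
        ∏ s, coeffWord (ps s) (envRep (envWord (p.2 s))) := by
    simp [moduleCoeff, moduleElement]
  rw [h]
  simp only [envRep_envWord, coeffWord_word]
  split_ifs with hp
  · subst hp
    simp
  · obtain ⟨s, hs⟩ := Function.ne_iff.1 hp
    rw [Finset.prod_eq_zero (Finset.mem_univ s) (if_neg hs), mul_zero]

/-- The functionals detect the words in the `U(a)` factors exactly, so triangularity is needed only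
in the `U(nbar)` factor. -/
theorem linearIndependent_moduleElement :
    LinearIndependent ℂ fun p : moduleLabelSet T N (Finset.univ : Finset (Fin m)) =>
      moduleElement p.1 := by
  classical
  have hn : ∀ p : moduleLabelSet T N (Finset.univ : Finset (Fin m)),
      (letters p.1.1.flatten).Nodup := fun p =>
    Multiset.coe_nodup.1 (Multiset.nodup_of_le (Multiset.le_add_right _ _)
      (p.2.2 ▸ Finset.univ.nodup))
  refine linearIndependent_of_triangular _ (fun p => moduleCoeff p.1.1.flatten p.1.2)
    (fun p => (letters p.1.1.flatten).reverse) (fun p => ?_) (fun p q hne hc => ?_)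
  · rw [moduleCoeff_moduleElement, if_pos rfl]
    exact coeffWord_lyndonProd_self p.2.1 (hn p)
  · rw [moduleCoeff_moduleElement] at hc
    by_cases h : q.1.2 = p.1.2
    · rw [if_pos h] at hc
      exact lt_of_coeffWord_ne_zero q.2.1 p.2.1 (hn q)
        (fun h' => hne (Subtype.ext (Prod.ext h' h))) hc
    · rw [if_neg h] at hc
      exact absurd rfl hc

omit [NeZero T] in
theorem mem_moduleLabelSet_univ
    {p : List (List (Fin m × ZMod T)) × (Fin N → List (Fin m × ZMod T))} :
    p ∈ moduleLabelSet T N Finset.univ ↔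
      IsLabel p.1 ∧ content p.1.flatten + ∑ s, content (p.2 s) = ones m := by
  rw [moduleLabelSet, Set.mem_ofPred_eq, coe_eq_univ_val_iff, funext_iff]
  refine and_congr_right fun _ => forall_congr' fun i => ?_
  rw [Multiset.count_add, Multiset.count_sum', Pi.add_apply, Finset.sum_apply]
  simp only [Multiset.coe_count]
  rfl

theorem span_moduleElement :
    Submodule.span ℂ (Set.range fun p : moduleLabelSet T N (Finset.univ : Finset (Fin m)) =>
      moduleElement p.1) = moduleMWeight (ones m) := by
  apply le_antisymm
  · refine Submodule.span_le.2 ?_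
    rintro _ ⟨⟨⟨ws, ps⟩, hp⟩, rfl⟩
    obtain ⟨hlab, hsum⟩ := mem_moduleLabelSet_univ.1 hp
    refine Submodule.subset_span ⟨content ws.flatten, fun s => content (ps s), lyndonProd ws,
      fun s => envWord (ps s), hsum, ?_, fun s => ?_, rfl⟩
    · rw [uNbarWeight_eq_labelSpan (hsum ▸ le_self_add)]
      exact Submodule.subset_span ⟨ws, hlab, rfl, rfl⟩
    · rw [uFreeWeight_eq]
      exact envWord_mem _
  · refine Submodule.span_le.2 ?_
    rintro _ ⟨r, s, u, v, hsum, hu, hv, rfl⟩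
    rw [uNbarWeight_eq_labelSpan (hsum ▸ le_self_add)] at hu
    simp only [uFreeWeight_eq] at hv
    have h := Submodule.apply_mem_map₂ (TensorProduct.mk ℂ _ _) hu
      (multilinearMap_mem_span (PiTensorProduct.tprod ℂ) hv)
    rw [labelSpan, Submodule.map₂_span_span] at h
    refine Submodule.span_mono ?_ h
    rintro _ ⟨_, ⟨ws, hws, rfl, rfl⟩, _, ⟨a, ha, rfl⟩, rfl⟩
    choose ps hps ha using ha
    refine ⟨⟨(ws, ps), mem_moduleLabelSet_univ.2 ⟨hws, ?_⟩⟩, ?_⟩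
    · simp only [hps]
      exact hsum
    · obtain rfl : a = fun i => envWord (ps i) := funext ha
      rfl

theorem finrank_moduleMWeight :
    Module.finrank ℂ (moduleMWeight (m := m) (T := T) (N := N) (ones m)) = labelCount N T m := by
  obtain ⟨F, hF, hcard⟩ := exists_finset_moduleLabelSet (T := T) N (Finset.univ : Finset (Fin m))
  let _ : Fintype (moduleLabelSet T N (Finset.univ : Finset (Fin m))) := Fintype.subtype F hF
  have h : Fintype.card (moduleLabelSet T N (Finset.univ : Finset (Fin m))) = F.card :=
    Fintype.subtype_card F hF
  rw [← span_moduleElement, finrank_span_eq_card linearIndependent_moduleElement, h, hcard,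
    Finset.card_univ, Fintype.card_fin]

end TensorProducts

end Cyclotomic

end

theorem mainTheorem12 (m N T : ℕ) [NeZero T] (ω : ℂ) (hω : IsPrimitiveRoot ω T)
    (z : Fin N → ℂ) (hz : ∀ i, z i ≠ 0)
    (horb : ∀ i j : Fin N, i ≠ j → ∀ k : ℕ, z i ≠ ω ^ k * z j) :
    (Module.finrank ℂ (Cyclotomic.moduleMWeight (T := T) (N := N) (Cyclotomic.ones m))
        = Module.finrank ℂ (Cyclotomic.FlagSpace (Cyclotomic.arrangement m ω z) m) ∧
      Module.finrank ℂ (Cyclotomic.FlagSpace (Cyclotomic.arrangement m ω z) m)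
        = ∏ k ∈ Finset.range m, (1 + (k + N) * T)) ∧
    (Module.finrank ℂ (Cyclotomic.uNbarWeight (T := T) (Cyclotomic.ones m))
        = Module.finrank ℂ
            (Cyclotomic.FlagSpace (Cyclotomic.arrangement m ω (Fin.elim0 : Fin 0 → ℂ)) m) ∧
      Module.finrank ℂ
          (Cyclotomic.FlagSpace (Cyclotomic.arrangement m ω (Fin.elim0 : Fin 0 → ℂ)) m)
        = ∏ k ∈ Finset.Ico 1 m, (1 + k * T)) ∧
    (LinearIndependent ℂ (Cyclotomic.lyndonElement (m := m) (T := T)) ∧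
      Submodule.span ℂ (Set.range (Cyclotomic.lyndonElement (m := m) (T := T)))
        = Cyclotomic.uNbarWeight (Cyclotomic.ones m)) := by
  have hM := Cyclotomic.finrank_moduleMWeight (m := m) (T := T) (N := N)
  have hF := Cyclotomic.finrank_flagSpace_arrangement (m := m) hω hz horb
  have hU := Cyclotomic.finrank_uNbarWeight (m := m) (T := T)
  have hF₀ := Cyclotomic.finrank_flagSpace_arrangement (m := m) (z := (Fin.elim0 : Fin 0 → ℂ)) hω
    (fun i => i.elim0) (fun i => i.elim0)
  refine ⟨⟨hM.trans hF.symm, hF⟩, ⟨hU.trans hF₀.symm, hF₀.trans ?_⟩,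
    Cyclotomic.linearIndependent_lyndonElement, Cyclotomic.span_lyndonElement⟩
  simp only [add_zero]
  rw [Finset.range_eq_Ico]
  -- The factor at `k = 0` is 1 and may be dropped; for `m = 0` both products are empty.
  rcases Nat.eq_zero_or_pos m with rfl | hm
  · rfl
  · rw [Finset.prod_eq_prod_Ico_succ_bot hm, zero_mul, add_zero, one_mul]
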